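/- Let $K$ be a field, $n\ge 2$ an integer, and $R_n$ the rose with $n$ petals: the directed graph with one vertex $v$ and $n$ loops $e_1,\dots,e_n$. Let $L=L_K(R_n)$ be its Leavitt path algebra, that is, the unital $K$-algebra with identity $v$ generated by $v,e_1,\dots,e_n,e_1^*,\dots,e_n^*$ subject to $v^2=v$, $ve_i=e_i=e_iv$, $ve_i^*=e_i^*=e_i^*v$, $e_i^*e_j=\delta_{i,j}v$ and $\sum_{i=1}^n e_ie_i^*=v$. Closed paths in $R_n$ are nonempty words in $e_1,\dots,e_n$, regarded also as elements of $L$. A closed path $c$ is simple if $c\ne d^k$ for every closed path $d$ and every integer $k\ge 2$; $\Pi_c$ denotes the set of all cyclic rotations of the word $c$. Let $C_s(R_n)$ be the set of simple closed paths of the form $e_{k_1}\cdots e_{k_m}$ with $k_m=2$ and $k_i\neq 2$ for $1\le i\le m-1$. Let $\mathrm{Irr}(K[x])$ be the set of irreducible polynomials in $K[x]$ with constant term $1$. For a simple closed path $c$ and $f=1-a_1x-\cdots-a_sx^s\in\mathrm{Irr}(K[x])$, let $S^f_c$ be the cyclic left $L$-module generated by an element $z$ subject to $z=(a_1c+\cdots+a_sc^s)z$,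 i.e. $S^f_c=L/Lf(c)$. For $\beta\in\Pi_\alpha$ the modules $S^f_\beta$ are isomorphic to each other; $S^f_{\Pi_\alpha}$ denotes any left $L$-module isomorphic to one of them. Let $A_{R_n}(e_1,e_2)$ be the $K$-subalgebra of $L$ generated by $v,e_1,e_3,\dots,e_n,e_2^*,\dots,e_n^*$. For $p\in A_{R_n}(e_1,e_2)$ let $\sigma_p$ be the $K$-algebra automorphism of $L$ with $\sigma_p(e_2)=e_2+e_1p$ and $\sigma_p(e_1^*)=e_1^*-pe_2^*$ which fixes all the other generators (it fixes $A_{R_n}(e_1,e_2)$ elementwise, and $\sigma_p^{-1}=\sigma_{-p}$). Let $S^{f,p}_c$ be the twist of $S^f_c$ by $\sigma_p$: the same abelian group with the action $r*y=\sigma_p(r)y$. Let $p,q\in A_{R_n}(e_1,e_2)$, $c,d\in C_s(R_n)$ and $f,g\in\mathrm{Irr}(K[x])$. Then: (1) $S^{f,p}_c$ is a simple left $L$-module. (2) $S^{f,p}_c\cong S^{g,q}_d$ as left $L$-modules if and only if $f=g$, $c=d$, and $p-q=rf(c)$ for some $r\in L$. (3) For every simple closed path $\alpha$ in $R_n$,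 $S^{f,p}_c\cong S^f_{\Pi_\alpha}$ as left $L$-modules if and only if $\alpha\in\Pi_c$ and $p=rf(c)$ for some $r\in L$. (4) $\mathrm{End}_L(S^{f,p}_c)\cong K[x]/K[x]f(x)$ as $K$-algebras (in particular as rings). (5) $S^{f,p}_c\cong L/Lf(\sigma_p^{-1}(c))$ as left $L$-modules. -/

import Mathlib

open Polynomial

noncomputable section

namespace LeavittRose

/-- The generators `v`, `e_i`, `e_i^*` of the Leavitt path algebra of the rose with `n` petals.
The petals are indexed by `Fin n`, so that the petal `e_i` of the literature has index `i - 1`. -/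
inductive Gen (n : ℕ) : Type
  | v : Gen n
  | e : Fin n → Gen n
  | es : Fin n → Gen n

/-- The defining relations of `L_K(R_n)`; the last one says that the vertex `v` is the identity of
the algebra. -/
inductive Rel (K : Type*) [Field K] (n : ℕ) :
    FreeAlgebra K (Gen n) → FreeAlgebra K (Gen n) → Prop
  | v_mul_v : Rel K n (FreeAlgebra.ι K Gen.v * FreeAlgebra.ι K Gen.v) (FreeAlgebra.ι K Gen.v)
  | v_mul_e (i : Fin n) :
      Rel K n (FreeAlgebra.ι K Gen.v * FreeAlgebra.ι K (Gen.e i)) (FreeAlgebra.ι K (Gen.e i))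
  | e_mul_v (i : Fin n) :
      Rel K n (FreeAlgebra.ι K (Gen.e i) * FreeAlgebra.ι K Gen.v) (FreeAlgebra.ι K (Gen.e i))
  | v_mul_es (i : Fin n) :
      Rel K n (FreeAlgebra.ι K Gen.v * FreeAlgebra.ι K (Gen.es i)) (FreeAlgebra.ι K (Gen.es i))
  | es_mul_v (i : Fin n) :
      Rel K n (FreeAlgebra.ι K (Gen.es i) * FreeAlgebra.ι K Gen.v) (FreeAlgebra.ι K (Gen.es i))
  | es_mul_e (i j : Fin n) :
      Rel K n (FreeAlgebra.ι K (Gen.es i) * FreeAlgebra.ι K (Gen.e j))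
        (if i = j then FreeAlgebra.ι K Gen.v else 0)
  | sum_e_mul_es :
      Rel K n (∑ i : Fin n, FreeAlgebra.ι K (Gen.e i) * FreeAlgebra.ι K (Gen.es i))
        (FreeAlgebra.ι K Gen.v)
  | v_eq_one : Rel K n (FreeAlgebra.ι K Gen.v) 1

/-- The Leavitt path algebra `L_K(R_n)` of the rose with `n` petals. -/
def LPA (K : Type*) [Field K] (n : ℕ) : Type _ := RingQuot (Rel K n)

instance (K : Type*) [Field K] (n : ℕ) : Ring (LPA K n) :=
  inferInstanceAs (Ring (RingQuot (Rel K n)))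

instance (K : Type*) [Field K] (n : ℕ) : Algebra K (LPA K n) :=
  inferInstanceAs (Algebra K (RingQuot (Rel K n)))

/-- The quotient map from the free algebra. -/
def mk (K : Type*) [Field K] (n : ℕ) : FreeAlgebra K (Gen n) →ₐ[K] LPA K n :=
  RingQuot.mkAlgHom K (Rel K n)

/-- The vertex `v` as an element of `L_K(R_n)`. -/
def v (K : Type*) [Field K] (n : ℕ) : LPA K n := mk K n (FreeAlgebra.ι K Gen.v)

/-- The real edge `e_i` as an element of `L_K(R_n)`. -/
def e (K : Type*) [Field K] {n : ℕ} (i : Fin n) : LPA K n := mk K n (FreeAlgebra.ι K (Gen.e i))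

/-- The ghost edge `e_i^*` as an element of `L_K(R_n)`. -/
def es (K : Type*) [Field K] {n : ℕ} (i : Fin n) : LPA K n := mk K n (FreeAlgebra.ι K (Gen.es i))

theorem mk_eq {K : Type*} [Field K] {n : ℕ} {x y : FreeAlgebra K (Gen n)} (h : Rel K n x y) :
    mk K n x = mk K n y :=
  RingQuot.mkAlgHom_rel K h

theorem v_eq_one (K : Type*) [Field K] (n : ℕ) : v K n = 1 := by
  have h := mk_eq (Rel.v_eq_one (K := K) (n := n))
  rwa [map_one] at h

theorem es_mul_e {K : Type*} [Field K] {n : ℕ} (i j : Fin n) :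
    es K i * e K j = if i = j then 1 else 0 := by
  have h := mk_eq (Rel.es_mul_e (K := K) i j)
  rw [map_mul] at h
  refine Eq.trans h ?_
  split_ifs
  · exact v_eq_one K n
  · exact map_zero _

theorem sum_e_mul_es (K : Type*) [Field K] (n : ℕ) :
    ∑ i : Fin n, e K i * es K i = 1 := by
  have h := mk_eq (Rel.sum_e_mul_es (K := K) (n := n))
  rw [map_sum] at h
  simp only [map_mul] at h
  exact h.trans (v_eq_one K n)

/-- The universal property of `L_K(R_n)` (existence part). -/
def lift {K : Type*} [Field K] {n : ℕ} {B : Type*} [Ring B] [Algebra K B] (x y : Fin n → B)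
    (hyx : ∀ i j, y i * x j = if i = j then 1 else 0) (hxy : ∑ i, x i * y i = 1) :
    LPA K n →ₐ[K] B :=
  RingQuot.liftAlgHom K ⟨FreeAlgebra.lift K (fun g : Gen n => match g with
    | Gen.v => 1
    | Gen.e i => x i
    | Gen.es i => y i), by
      intro a b h
      cases h with
      | es_mul_e i j =>
        simp only [map_mul, FreeAlgebra.lift_ι_apply, hyx]
        split_ifs <;> simp
      | sum_e_mul_es => simp [hxy]
      | _ => simp⟩

theorem lift_e {K : Type*} [Field K] {n : ℕ} {B : Type*} [Ring B] [Algebra K B] (x y : Fin n → B)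
    (hyx : ∀ i j, y i * x j = if i = j then 1 else 0) (hxy : ∑ i, x i * y i = 1) (i : Fin n) :
    lift (K := K) x y hyx hxy (e K i) = x i :=
  (RingQuot.liftAlgHom_mkAlgHom_apply K _ _ _).trans (FreeAlgebra.lift_ι_apply _ _)

theorem lift_es {K : Type*} [Field K] {n : ℕ} {B : Type*} [Ring B] [Algebra K B] (x y : Fin n → B)
    (hyx : ∀ i j, y i * x j = if i = j then 1 else 0) (hxy : ∑ i, x i * y i = 1) (i : Fin n) :
    lift (K := K) x y hyx hxy (es K i) = y i :=
  (RingQuot.liftAlgHom_mkAlgHom_apply K _ _ _).trans (FreeAlgebra.lift_ι_apply _ _)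

theorem algHom_ext {K : Type*} [Field K] {n : ℕ} {B : Type*} [Ring B] [Algebra K B]
    {φ ψ : LPA K n →ₐ[K] B} (he : ∀ i, φ (e K i) = ψ (e K i))
    (hes : ∀ i, φ (es K i) = ψ (es K i)) : φ = ψ := by
  refine RingQuot.ringQuot_ext' K φ ψ (FreeAlgebra.hom_ext (funext fun g => ?_))
  cases g with
  | v =>
    change φ (v K n) = ψ (v K n)
    rw [v_eq_one, map_one, map_one]
  | e i => exact he i
  | es i => exact hes i

/-- The index of the petal `e_1`. -/
def first {n : ℕ} (hn : 2 ≤ n) : Fin n := ⟨0, by omega⟩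

/-- The index of the petal `e_2`. -/
def second {n : ℕ} (hn : 2 ≤ n) : Fin n := ⟨1, by omega⟩

theorem first_ne_second {n : ℕ} (hn : 2 ≤ n) : first hn ≠ second hn := by
  simp [first, second]

/-- The subalgebra `A_{R_n}(e_1, e_2)` of `L_K(R_n)`, generated by `v`, by the real edges other than
`e_2` and by the ghost edges other than `e_1^*`. -/
def A (K : Type*) [Field K] {n : ℕ} (hn : 2 ≤ n) : Subalgebra K (LPA K n) :=
  Algebra.adjoin K
    ({v K n} ∪ {x | ∃ i, i ≠ second hn ∧ x = e K i} ∪ {x | ∃ i, i ≠ first hn ∧ x = es K i})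

/-- The endomorphism of `L_K(R_n)` with `e_2 ↦ e_2 + e_1 p` and `e_1^* ↦ e_1^* - p e_2^*` that fixes
all other generators. -/
def sigmaHom {K : Type*} [Field K] {n : ℕ} (hn : 2 ≤ n) (p : LPA K n) : LPA K n →ₐ[K] LPA K n :=
  lift
    (fun i => if i = second hn then e K (second hn) + e K (first hn) * p else e K i)
    (fun i => if i = first hn then es K (first hn) - p * es K (second hn) else es K i)
    (by
      intro i j
      have h12 := first_ne_second hn
      have h21 := h12.symm
      have h1 : es K (first hn) * e K (first hn) = 1 := by simp [es_mul_e]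
      have h2 : es K (second hn) * e K (second hn) = 1 := by simp [es_mul_e]
      have h3 : es K (first hn) * e K (second hn) = 0 := by simp [es_mul_e, h12]
      have h4 : es K (second hn) * e K (first hn) = 0 := by simp [es_mul_e, h21]
      by_cases hi : i = first hn <;> by_cases hj : j = second hn
      · subst hi hj
        rw [if_pos rfl, if_pos rfl, if_neg h12, sub_mul, mul_add, mul_add, ← mul_assoc, h1, h3,
          mul_assoc, h2, ← mul_assoc, mul_assoc p, h4]
        simp
      · subst hi
        simp only [if_true, if_neg hj, sub_mul, mul_assoc, es_mul_e, if_neg (Ne.symm hj)]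
        simp
      · subst hj
        simp only [if_true, if_neg hi, mul_add, ← mul_assoc, es_mul_e]
        simp
      · simp only [if_neg hi, if_neg hj, es_mul_e])
    (by
      have h12 := first_ne_second hn
      have h21 := h12.symm
      have key : ∀ i : Fin n,
          (if i = second hn then e K (second hn) + e K (first hn) * p else e K i) *
            (if i = first hn then es K (first hn) - p * es K (second hn) else es K i) =
          e K i * es K i
            + (if i = second hn then e K (first hn) * p * es K (second hn) else 0)
            - (if i = first hn then e K (first hn) * p * es K (second hn) else 0) := by
        intro i
        by_cases hi : i = first hn
        · subst hi
          simp [h12, mul_sub, mul_assoc]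
        · by_cases hj : i = second hn
          · subst hj
            simp [h21, add_mul, mul_assoc]
          · simp [hi, hj]
      simp only [key, Finset.sum_sub_distrib, Finset.sum_add_distrib, sum_e_mul_es,
        Finset.sum_ite_eq', Finset.mem_univ, if_true]
      simp)

theorem sigmaHom_e {K : Type*} [Field K] {n : ℕ} (hn : 2 ≤ n) (p : LPA K n) (i : Fin n) :
    sigmaHom hn p (e K i) =
      if i = second hn then e K (second hn) + e K (first hn) * p else e K i :=
  lift_e _ _ _ _ i

theorem sigmaHom_es {K : Type*} [Field K] {n : ℕ} (hn : 2 ≤ n) (p : LPA K n) (i : Fin n) :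
    sigmaHom hn p (es K i) =
      if i = first hn then es K (first hn) - p * es K (second hn) else es K i :=
  lift_es _ _ _ _ i

theorem sigmaHom_fix {K : Type*} [Field K] {n : ℕ} (hn : 2 ≤ n) (p : LPA K n) {q : LPA K n}
    (hq : q ∈ A K hn) : sigmaHom hn p q = q := by
  have h : A K hn ≤ AlgHom.equalizer (sigmaHom hn p) (AlgHom.id K _) := by
    refine Algebra.adjoin_le ?_
    rintro x ((hx | ⟨i, hi, rfl⟩) | ⟨i, hi, rfl⟩)
    · rw [Set.mem_singleton_iff] at hx
      subst hx
      rw [v_eq_one]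
      exact one_mem _
    · change sigmaHom hn p (e K i) = e K i
      rw [sigmaHom_e, if_neg hi]
    · change sigmaHom hn p (es K i) = es K i
      rw [sigmaHom_es, if_neg hi]
  exact h hq

theorem sigmaHom_comp {K : Type*} [Field K] {n : ℕ} (hn : 2 ≤ n) (p q : LPA K n)
    (hq : q ∈ A K hn) (hpq : p + q = 0) :
    (sigmaHom hn p).comp (sigmaHom hn q) = AlgHom.id K (LPA K n) := by
  have h12 := first_ne_second hn
  have hqp : q = -p := by rw [eq_neg_iff_add_eq_zero, add_comm, hpq]
  have hfix := sigmaHom_fix hn p hq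
  refine algHom_ext (fun i => ?_) (fun i => ?_)
  · rw [AlgHom.comp_apply, sigmaHom_e]
    split_ifs with hi
    · rw [map_add, map_mul, hfix, sigmaHom_e, sigmaHom_e, if_pos rfl, if_neg h12, hqp, hi]
      simp
    · rw [sigmaHom_e, if_neg hi]
      rfl
  · rw [AlgHom.comp_apply, sigmaHom_es]
    split_ifs with hi
    · rw [map_sub, map_mul, hfix, sigmaHom_es, sigmaHom_es, if_pos rfl, if_neg h12.symm, hqp, hi]
      simp
    · rw [sigmaHom_es, if_neg hi]
      rfl

/-- The Anick type automorphism `σ_p` of `L_K(R_n)`, for `p ∈ A_{R_n}(e_1, e_2)`. -/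
def sigma {K : Type*} [Field K] {n : ℕ} (hn : 2 ≤ n) (p : A K hn) : LPA K n ≃ₐ[K] LPA K n :=
  AlgEquiv.ofAlgHom (sigmaHom hn (p : LPA K n)) (sigmaHom hn (-(p : LPA K n)))
    (sigmaHom_comp hn _ _ (neg_mem p.2) (by simp))
    (sigmaHom_comp hn _ _ p.2 (by simp))

/-- A simple closed path of `R_n`. As `R_n` has one vertex, its closed paths are the nonempty words
in the petals. The power `d ^ k` of a word is the concatenation of `k` copies of `d`. -/
def IsSimpleClosedPath {n : ℕ} (c : List (Fin n)) : Prop :=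
  c ≠ [] ∧ ∀ d : List (Fin n), d ≠ [] → ∀ k : ℕ, 2 ≤ k → c ≠ (List.replicate k d).flatten

/-- The set `C_s(R_n)` of the simple closed paths whose last edge is `e_2` and whose other edges
are different from `e_2`. -/
def Cs {n : ℕ} (hn : 2 ≤ n) : Set (List (Fin n)) :=
  {c | IsSimpleClosedPath c ∧
    ∃ w : List (Fin n), (∀ i ∈ w, i ≠ second hn) ∧ c = w ++ [second hn]}

/-- The set `Π_c` of the cyclic rotations of `c`. -/
def rotations {n : ℕ} (c : List (Fin n)) : Set (List (Fin n)) := {d | ∃ k : ℕ, d = c.rotate k}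

/-- The set `Irr(K[x])` of the irreducible polynomials of the form `1 - a_1 x - ⋯ - a_m x ^ m`. -/
def Irr (K : Type*) [Field K] : Set K[X] := {f | Irreducible f ∧ f.coeff 0 = 1}

/-- The element of `L_K(R_n)` given by a path. -/
def pathElt (K : Type*) [Field K] {n : ℕ} (c : List (Fin n)) : LPA K n := (c.map (e K)).prod

/-- The cyclic left `L_K(R_n)`-module `S^f_c` with one generator `z` (the class of `1`) and the
relation `f(c) z = 0`, which for `f = 1 - a_1 x - ⋯ - a_m x ^ m` reads
`z = (a_1 c + ⋯ + a_m c ^ m) z`. -/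
abbrev S {K : Type*} [Field K] {n : ℕ} (f : K[X]) (c : List (Fin n)) : Type _ :=
  LPA K n ⧸ Submodule.span (LPA K n) {aeval (pathElt K c) f}

/-- The twist `M^σ` of a left module `M` by an automorphism `σ`: the same abelian group, with the
action `r ∗ y = σ(r) y`. -/
def Twist {K R : Type*} [Field K] [Ring R] [Algebra K R] (_σ : R ≃ₐ[K] R) (M : Type*) : Type _ := M

instance {K R : Type*} [Field K] [Ring R] [Algebra K R] (σ : R ≃ₐ[K] R) (M : Type*)
    [AddCommGroup M] : AddCommGroup (Twist σ M) := inferInstanceAs (AddCommGroup M)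

instance {K R : Type*} [Field K] [Ring R] [Algebra K R] (σ : R ≃ₐ[K] R) (M : Type*)
    [AddCommGroup M] [Module R M] : Module R (Twist σ M) :=
  Module.compHom M (σ : R →+* R)

instance {K R : Type*} [Field K] [Ring R] [Algebra K R] (σ : R ≃ₐ[K] R) (M : Type*)
    [AddCommGroup M] [Module K M] : Module K (Twist σ M) := inferInstanceAs (Module K M)

instance {K R : Type*} [Field K] [Ring R] [Algebra K R] (σ : R ≃ₐ[K] R) (M : Type*)
    [AddCommGroup M] [Module R M] [Module K M] [IsScalarTower K R M] :
    IsScalarTower K R (Twist σ M) where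
  smul_assoc k r y := by
    have h : ∀ x : M, σ (k • r) • x = k • (σ r • x) := fun x => by rw [map_smul, smul_assoc]
    exact h y

/-- The module `S^{f, p}_c`, the twist of `S^f_c` by `σ_p`. -/
abbrev Sp {K : Type*} [Field K] {n : ℕ} (hn : 2 ≤ n) (f : K[X]) (p : A K hn)
    (c : List (Fin n)) : Type _ :=
  Twist (sigma hn p) (S f c)

/-- `M` is a model of the module `S^f_{Π_α}`, that is, it represents the isomorphism class
of the modules `S^f_β` with `β ∈ Π_α`. -/
def IsSPi {K : Type*} [Field K] {n : ℕ} (f : K[X]) (α : List (Fin n)) (M : Type*)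
    [AddCommGroup M] [Module (LPA K n) M] : Prop :=
  ∃ β ∈ rotations α, Nonempty (M ≃ₗ[LPA K n] S f β)

end LeavittRose

end

open LeavittRose

namespace LeavittRose

/-! ### Finite words prepended to infinite words -/

section Words

variable {α : Type*}

/-! Everything is computed in one concrete model. Let `F = K[x]/(f)` and let `b` be the class of
`x`. The algebra acts on `F`-valued functions on infinite words, edges prepending letters and ghost
edges deleting them, with the factor `b` paid whenever an edge produces `ω₀ = d^∞`. As `d` is not a
proper power, `d` acts on the indicator `δ` of `ω₀` as `b`, so `z ↦ δ` defines a map from `S^f_d`.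
It is injective (`toChen_injective`) by a normal form for elements of `S^f_d`. Its image lies among
the functions of finite support, where a long ghost path isolates one point; this gives simplicity
(`exists_smul_eq_gen`).

The twist `S^{f,p}_c` is `L/Lf(σ_p⁻¹(c))`, hence is isomorphic to a simple module `N` iff
`f(σ_p⁻¹(c))` kills a nonzero element of `N`. For `c = w e_2` and `N` a twist by `σ_q`, this asks
when `f(x)` kills some `φ ≠ 0` in the untwisted module, where `x = w(e_2 - e_1 t)` and `t = p - q`.
The term `w e_1 t` cannot cancel what `w e_2` places on words beginning with `w e_2`, so a point `ω`
in the support of `φ` yields `c^k ω` in the support of `x^k φ`. All `x^k φ` lie in the span of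
finitely many of them, so these points repeat and `ω = c^∞`
(`Chen.append_eq_of_aeval_smul_eq_zero`). The same applied to `xφ` forces `tφ = 0`. When `c = d`,
`φ` is thus a multiple of `δ`, which `t` kills, so `t` lies in the annihilator `Lg(c)` of `z`, and
`f(b) = 0` identifies the polynomials. The case `t = 0` also computes the endomorphisms. -/

theorem exists_eq_pow_of_append_comm (u v : List α) (h : u ++ v = v ++ u) :
    ∃ (w : List α) (i j : ℕ),
      u = (List.replicate i w).flatten ∧ v = (List.replicate j w).flatten := by
  induction hk : u.length + v.length using Nat.strong_induction_on generalizing u v with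
  | _ k ih =>
    rcases eq_or_ne u [] with rfl | hu
    · exact ⟨v, 0, 1, by simp, by simp⟩
    rcases eq_or_ne v [] with rfl | hv
    · exact ⟨u, 1, 0, by simp, by simp⟩
    have hu' := List.length_pos_of_ne_nil hu
    have hv' := List.length_pos_of_ne_nil hv
    -- Euclid's algorithm on lengths: the shorter word is a prefix of the longer, and it commutes
    -- with what is left after removing it.
    rcases List.append_eq_append_iff.1 h with ⟨t, rfl, h2⟩ | ⟨t, rfl, h2⟩
    · obtain ⟨w, i, j, hi, hj⟩ := ih (u.length + t.length)
        (by rw [List.length_append] at hk; omega) u t h2 rfl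
      exact ⟨w, i, i + j, hi, by rw [List.replicate_add, List.flatten_append, ← hi, ← hj]⟩
    · obtain ⟨w, i, j, hi, hj⟩ := ih (v.length + t.length)
        (by rw [List.length_append] at hk; omega) v t h2 rfl
      exact ⟨w, i + j, i, by rw [List.replicate_add, List.flatten_append, ← hi, ← hj], hi⟩

theorem pow_append_stream {u : List α} {ω : Stream' α} (h : u ++ₛ ω = ω) (k : ℕ) :
    (List.replicate k u).flatten ++ₛ ω = ω := by
  induction k with
  | zero => simp
  | succ k ih => rw [List.replicate_succ, List.flatten_cons, Stream'.append_append_stream, ih, h]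

/-- Both products are prefixes of `ω` of the same length. -/
theorem append_comm_of_append_stream {u v : List α} {ω : Stream' α} (hu : u ++ₛ ω = ω)
    (hv : v ++ₛ ω = ω) : u ++ v = v ++ u := by
  refine Stream'.append_left_injective _ _ ω ω ?_ (by simp [add_comm])
  rw [Stream'.append_append_stream, Stream'.append_append_stream, hu, hv, hu]

theorem length_pow (u : List α) (k : ℕ) :
    ((List.replicate k u).flatten).length = k * u.length := by
  simp

theorem eq_of_append_stream_eq {u : List α} (hu : u ≠ []) {ω ω' : Stream' α}
    (h : u ++ₛ ω = ω) (h' : u ++ₛ ω' = ω') : ω = ω' := by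
  ext k
  have hl : k < ((List.replicate (k + 1) u).flatten).length := by
    rw [length_pow]
    have := List.length_pos_of_ne_nil hu
    nlinarith
  rw [← pow_append_stream h (k + 1), ← pow_append_stream h' (k + 1),
    Stream'.get_append_left _ _ _ hl, Stream'.get_append_left _ _ _ hl]

end Words

/-! ### Primitive words, their rotations and their periodic infinite words -/

section SimplePaths

variable {n : ℕ} {c d : List (Fin n)}

theorem IsSimpleClosedPath.exists_eq_pow (hd : IsSimpleClosedPath d) {u : List (Fin n)}
    (h : u ++ d = d ++ u) : ∃ k, u = (List.replicate k d).flatten := by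
  obtain ⟨w, i, j, hi, hj⟩ := exists_eq_pow_of_append_comm u d h
  have hw : w ≠ [] := by
    rintro rfl
    exact hd.1 (by simp [hj])
  obtain rfl : j = 1 := by
    rcases Nat.lt_or_ge j 2 with h2 | h2
    · have : j ≠ 0 := by
        rintro rfl
        exact hd.1 (by simp [hj])
      omega
    · exact absurd hj (hd.2 w hw j h2)
  refine ⟨i, ?_⟩
  rw [hi, hj]
  simp

theorem IsSimpleClosedPath.exists_eq_pow_of_stream (hd : IsSimpleClosedPath d)
    {u : List (Fin n)} {ω : Stream' (Fin n)} (hω : d ++ₛ ω = ω) (h : u ++ₛ ω = ω) :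
    ∃ k, u = (List.replicate k d).flatten :=
  hd.exists_eq_pow (append_comm_of_append_stream h hω)

theorem IsSimpleClosedPath.eq_of_stream (hc : IsSimpleClosedPath c) (hd : IsSimpleClosedPath d)
    {ω : Stream' (Fin n)} (h : c ++ₛ ω = ω) (h' : d ++ₛ ω = ω) : c = d := by
  obtain ⟨k, hk⟩ := hd.exists_eq_pow_of_stream h' h
  rcases Nat.lt_or_ge k 2 with h2 | h2
  · interval_cases k
    · exact absurd (by simpa using hk) hc.1
    · simpa using hk
  · exact absurd hk (hc.2 d hd.1 k h2)

theorem IsSimpleClosedPath.rotate_one (hc : IsSimpleClosedPath c) :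
    IsSimpleClosedPath (c.rotate 1) := by
  refine ⟨fun h => hc.1 (by simpa using h), fun d hd k hk h => ?_⟩
  obtain ⟨w, i, rfl⟩ : ∃ w i, d = w ++ [i] :=
    ⟨_, _, (List.dropLast_append_getLast hd).symm⟩
  -- The identity `i (w i)^k = (i w)^k i` carries a power decomposition of the rotated word back to
  -- `c`.
  have key : ∀ k, [i] ++ (List.replicate k (w ++ [i])).flatten =
      (List.replicate k ([i] ++ w)).flatten ++ [i] := by
    intro k
    induction k with
    | zero => simp
    | succ k ih =>
      rw [List.replicate_succ, List.flatten_cons, List.replicate_succ, List.flatten_cons,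
        List.append_assoc ([i] ++ w), ← ih]
      simp
  refine hc.2 ([i] ++ w) (by simp) k hk ?_
  cases c with
  | nil => exact absurd rfl hc.1
  | cons j t =>
    have h1 : t ++ [j] = (List.replicate k (w ++ [i])).flatten := by simpa using h
    have h2 := key k
    rw [← h1, ← List.append_assoc] at h2
    have h3 := List.append_inj' h2 rfl
    obtain rfl : j = i := by simpa using h3.2
    simpa using h3.1

theorem IsSimpleClosedPath.rotate (hc : IsSimpleClosedPath c) (k : ℕ) :
    IsSimpleClosedPath (c.rotate k) := by
  induction k with
  | zero => simpa using hc
  | succ k ih => simpa [List.rotate_rotate] using ih.rotate_one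

theorem mem_rotations_of_mem {b : List (Fin n)} (h : b ∈ rotations c) (h' : d ∈ rotations c) :
    d ∈ rotations b := by
  obtain ⟨k, rfl⟩ := h
  obtain ⟨l, rfl⟩ := h'
  exact ((List.IsRotated.forall c k).trans (List.IsRotated.forall c l).symm).imp
    fun _ hm => hm.symm

theorem mem_rotations_symm (h : d ∈ rotations c) : c ∈ rotations d :=
  mem_rotations_of_mem h ⟨0, by simp⟩

/-- Deleting the first letter of `c^∞` rotates its period by one. Once `s` is deleted both words are
periods of `ω₀`, and a primitive period is unique. -/
theorem mem_rotations_of_stream (hc : IsSimpleClosedPath c) (hd : IsSimpleClosedPath d)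
    {ω ω₀ : Stream' (Fin n)} (hω : c ++ₛ ω = ω) (hω₀ : d ++ₛ ω₀ = ω₀) (s : List (Fin n))
    (hs : ω = s ++ₛ ω₀) : d ∈ rotations c := by
  induction s generalizing c ω with
  | nil =>
    obtain rfl : ω = ω₀ := by simpa using hs
    exact ⟨0, by simp [hc.eq_of_stream hd hω hω₀]⟩
  | cons i s ih =>
    have h1 : (c.rotate 1) ++ₛ ω.tail = ω.tail := by
      cases c with
      | nil => exact absurd rfl hc.1
      | cons j t =>
        rw [List.rotate_cons_succ, List.rotate_zero, Stream'.append_append_stream]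
        rw [Stream'.cons_append_stream] at hω
        have h2 : ω.tail = t ++ₛ ω := by
          conv_lhs => rw [← hω]
          simp
        have h3 : [j] ++ₛ ω.tail = ω := by
          rw [h2]
          exact hω
        rw [h3, ← h2]
    obtain ⟨k, hk⟩ := ih hc.rotate_one h1 (by rw [hs]; simp [Stream'.cons_append_stream])
    exact ⟨1 + k, by rw [hk, List.rotate_rotate]⟩

/-- A nontrivial rotation of `w e_2` ends in a letter of `w`, which is not `e_2`. -/
theorem eq_of_mem_rotations_of_mem_Cs {hn : 2 ≤ n} (hc : c ∈ Cs hn) (hd : d ∈ Cs hn)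
    (h : d ∈ rotations c) : c = d := by
  obtain ⟨-, w, hw, rfl⟩ := hc
  obtain ⟨-, w', -, rfl⟩ := hd
  obtain ⟨k, hk⟩ := h
  rw [List.rotate_eq_drop_append_take_mod] at hk
  set l := k % (w ++ [second hn]).length
  have hl : l < (w ++ [second hn]).length := Nat.mod_lt _ (by simp)
  rcases Nat.eq_zero_or_pos l with h0 | h0
  · rw [hk, h0]
    simp
  · have hl' : l ≤ w.length := by simpa [Nat.lt_succ_iff] using hl
    rw [List.take_append_of_le_length hl'] at hk
    have hne : w.take l ≠ [] := by
      intro h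
      have := congrArg List.length h
      simp at this
      rcases this with h | rfl <;> simp_all
    have h1 := congrArg List.getLast? hk
    rw [List.getLast?_append_of_ne_nil _ hne, List.getLast?_append_of_ne_nil _ (by simp)] at h1
    have h2 : second hn ∈ w.take l := List.mem_of_getLast? (by simpa using h1.symm)
    exact absurd rfl (hw _ (List.mem_of_mem_take h2))

end SimplePaths

/-! ### The twisted action on functions on infinite words -/

section Chen

variable {K F : Type*} [Field K] [Field F] [Algebra K F] {n : ℕ}

open Classical in
/-- The weight on infinite words which is `b` at `ω₀` and `1` elsewhere. -/
noncomputable def weight (b : Fˣ) (ω₀ ω : Stream' (Fin n)) : F := if ω = ω₀ then b else 1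

theorem weight_ne_zero (b : Fˣ) (ω₀ ω : Stream' (Fin n)) : weight b ω₀ ω ≠ 0 := by
  unfold weight
  split_ifs <;> simp

/-- The action of a real edge on functions on infinite words. -/
noncomputable def edgeMap (b : Fˣ) (ω₀ : Stream' (Fin n)) (i : Fin n) :
    Module.End F (Stream' (Fin n) → F) where
  toFun φ ω := if ω.head = i then weight b ω₀ ω * φ ω.tail else 0
  map_add' φ ψ := by
    ext ω
    by_cases h : ω.head = i <;> simp [h, mul_add]
  map_smul' a φ := by
    ext ω
    by_cases h : ω.head = i <;> simp [h, mul_left_comm]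

/-- The action of a ghost edge on functions on infinite words. -/
noncomputable def ghostMap (b : Fˣ) (ω₀ : Stream' (Fin n)) (i : Fin n) :
    Module.End F (Stream' (Fin n) → F) where
  toFun φ ω := (weight b ω₀ (Stream'.cons i ω))⁻¹ * φ (Stream'.cons i ω)
  map_add' φ ψ := by
    ext ω
    simp [mul_add]
  map_smul' a φ := by
    ext ω
    simp [mul_left_comm]

/-- The twisted action of `L_K(R_n)` on functions on infinite words. -/
noncomputable def chenHom (K : Type*) [Field K] [Algebra K F] (b : Fˣ) (ω₀ : Stream' (Fin n)) :
    LPA K n →ₐ[K] Module.End F (Stream' (Fin n) → F) :=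
  lift (edgeMap b ω₀) (ghostMap b ω₀)
    (by
      intro i j
      ext φ ω
      by_cases h : i = j <;>
        simp [edgeMap, ghostMap, h, weight_ne_zero, Module.End.mul_apply])
    (by
      ext φ ω
      simp only [LinearMap.sum_apply, Finset.sum_apply, Module.End.mul_apply]
      simp [edgeMap, ghostMap, weight_ne_zero])

/-- Functions on infinite words, as an `L_K(R_n)`-module. -/
def Chen (K : Type*) {F : Type*} [Field K] [Field F] [Algebra K F] {n : ℕ} (_b : Fˣ)
    (_ω₀ : Stream' (Fin n)) : Type _ := Stream' (Fin n) → F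

instance (b : Fˣ) (ω₀ : Stream' (Fin n)) : AddCommGroup (Chen K b ω₀) :=
  inferInstanceAs (AddCommGroup (Stream' (Fin n) → F))

instance (b : Fˣ) (ω₀ : Stream' (Fin n)) : Module F (Chen K b ω₀) :=
  inferInstanceAs (Module F (Stream' (Fin n) → F))

instance (b : Fˣ) (ω₀ : Stream' (Fin n)) : Module K (Chen K b ω₀) :=
  inferInstanceAs (Module K (Stream' (Fin n) → F))

noncomputable instance (b : Fˣ) (ω₀ : Stream' (Fin n)) : Module (LPA K n) (Chen K b ω₀) :=
  Module.compHom (Stream' (Fin n) → F) (chenHom K b ω₀).toRingHom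

namespace Chen

variable {b : Fˣ} {ω₀ : Stream' (Fin n)}

instance : IsScalarTower K (LPA K n) (Chen K b ω₀) where
  smul_assoc k r φ := by
    change chenHom K b ω₀ (k • r) φ = k • (chenHom K b ω₀ r φ)
    rw [map_smul]
    rfl

instance : SMulCommClass (LPA K n) F (Chen K b ω₀) where
  smul_comm r a φ := map_smul (chenHom K b ω₀ r) a φ

theorem e_smul_apply (i : Fin n) (φ : Chen K b ω₀) (ω : Stream' (Fin n)) :
    (e K i • φ : Chen K b ω₀) ω = if ω.head = i then weight b ω₀ ω * φ ω.tail else 0 := by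
  change chenHom K b ω₀ (e K i) φ ω = _
  rw [chenHom, lift_e]
  rfl

theorem es_smul_apply (i : Fin n) (φ : Chen K b ω₀) (ω : Stream' (Fin n)) :
    (es K i • φ : Chen K b ω₀) ω =
      (weight b ω₀ (Stream'.cons i ω))⁻¹ * φ (Stream'.cons i ω) := by
  change chenHom K b ω₀ (es K i) φ ω = _
  rw [chenHom, lift_es]
  rfl

theorem add_apply (φ ψ : Chen K b ω₀) (ω : Stream' (Fin n)) : (φ + ψ) ω = φ ω + ψ ω := rfl

theorem sub_apply (φ ψ : Chen K b ω₀) (ω : Stream' (Fin n)) : (φ - ψ) ω = φ ω - ψ ω := rfl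

theorem zero_apply (ω : Stream' (Fin n)) : (0 : Chen K b ω₀) ω = 0 := rfl

theorem smul_apply (a : F) (φ : Chen K b ω₀) (ω : Stream' (Fin n)) : (a • φ) ω = a * φ ω := rfl

@[ext]
theorem ext {φ ψ : Chen K b ω₀} (h : ∀ ω, φ ω = ψ ω) : φ = ψ := funext h

end Chen

end Chen

/-! ### Paths, ghost paths and generation by edges -/

theorem pathElt_nil (K : Type*) [Field K] {n : ℕ} : pathElt K ([] : List (Fin n)) = 1 := rfl

theorem pathElt_cons (K : Type*) [Field K] {n : ℕ} (i : Fin n) (u : List (Fin n)) :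
    pathElt K (i :: u) = e K i * pathElt K u := by simp [pathElt]

theorem pathElt_append (K : Type*) [Field K] {n : ℕ} (u v : List (Fin n)) :
    pathElt K (u ++ v) = pathElt K u * pathElt K v := by simp [pathElt]

/-- The element of `L_K(R_n)` given by the ghost path of a path. -/
noncomputable def ghostElt (K : Type*) [Field K] {n : ℕ} (u : List (Fin n)) : LPA K n :=
  (u.reverse.map (es K)).prod

theorem ghostElt_cons (K : Type*) [Field K] {n : ℕ} (i : Fin n) (u : List (Fin n)) :
    ghostElt K (i :: u) = ghostElt K u * es K i := by simp [ghostElt]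

/-- A subalgebra of `L_K(R_n)` containing all edges is everything. -/
theorem subalgebra_eq_top {K : Type*} [Field K] {n : ℕ} (B : Subalgebra K (LPA K n))
    (he : ∀ i, e K i ∈ B) (hes : ∀ i, es K i ∈ B) : B = ⊤ := by
  have h : (B.val.comp (lift (K := K) (fun i => (⟨e K i, he i⟩ : B))
      (fun i => (⟨es K i, hes i⟩ : B))
      (by
        intro i j
        apply Subtype.ext
        refine (es_mul_e i j).trans ?_
        split_ifs <;> rfl)
      (by
        apply Subtype.ext
        simpa using sum_e_mul_es K n))) = AlgHom.id K _ :=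
    algHom_ext (fun i => by rw [AlgHom.comp_apply, lift_e]; rfl)
      (fun i => by rw [AlgHom.comp_apply, lift_es]; rfl)
  refine (Algebra.eq_top_iff).2 fun x => ?_
  have hx := DFunLike.congr_fun h x
  rw [AlgHom.id_apply] at hx
  rw [← hx]
  exact Subtype.property _

/-- A subspace of a module over `L_K(R_n)` stable under all edges is a submodule. -/
theorem smul_mem_of_edges {K : Type*} [Field K] {n : ℕ} {M : Type*} [AddCommGroup M] [Module K M]
    [Module (LPA K n) M] [IsScalarTower K (LPA K n) M] (N : Submodule K M)
    (he : ∀ i : Fin n, ∀ x ∈ N, e K i • x ∈ N) (hes : ∀ i : Fin n, ∀ x ∈ N, es K i • x ∈ N)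
    (r : LPA K n) {x : M} (hx : x ∈ N) : r • x ∈ N := by
  let B : Subalgebra K (LPA K n) :=
    { carrier := {r : LPA K n | ∀ x ∈ N, r • x ∈ N}
      mul_mem' := fun {a b} ha hb x hx => by
        rw [mul_smul]
        exact ha _ (hb _ hx)
      add_mem' := fun {a b} ha hb x hx => by
        rw [add_smul]
        exact N.add_mem (ha _ hx) (hb _ hx)
      algebraMap_mem' := fun k x hx => by
        rw [Algebra.algebraMap_eq_smul_one, smul_assoc, one_smul]
        exact N.smul_mem _ hx }
  have hB : B = ⊤ := subalgebra_eq_top B he hes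
  have hr : r ∈ B := by
    rw [hB]
    trivial
  exact hr x hx

/-! ### Paths acting on functions; the eigenvector `δ` -/

namespace Chen

variable {K F : Type*} [Field K] [Field F] [Algebra K F] {n : ℕ}
variable {b : Fˣ} {ω₀ : Stream' (Fin n)}

theorem e_smul_cons (i : Fin n) (φ : Chen K b ω₀) (ω : Stream' (Fin n)) :
    (e K i • φ : Chen K b ω₀) (Stream'.cons i ω) = weight b ω₀ (Stream'.cons i ω) * φ ω := by
  simp [e_smul_apply]

theorem e_smul_cons_of_ne {i j : Fin n} (h : j ≠ i) (φ : Chen K b ω₀) (ω : Stream' (Fin n)) :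
    (e K i • φ : Chen K b ω₀) (Stream'.cons j ω) = 0 := by
  simp [e_smul_apply, h]

/-- The scalar is the product of the weights met while prepending `u` to `ω`, so it does not depend
on `φ`. -/
theorem pathElt_smul_append (u : List (Fin n)) (ω : Stream' (Fin n)) :
    ∃ a : F, a ≠ 0 ∧ ∀ φ : Chen K b ω₀, (pathElt K u • φ : Chen K b ω₀) (u ++ₛ ω) = a * φ ω := by
  induction u with
  | nil => exact ⟨1, one_ne_zero, fun φ => by simp [pathElt_nil]⟩
  | cons i u ih =>
    obtain ⟨a, ha, h⟩ := ih
    refine ⟨weight b ω₀ (Stream'.cons i (u ++ₛ ω)) * a, mul_ne_zero (weight_ne_zero _ _ _) ha,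
      fun φ => ?_⟩
    rw [pathElt_cons, mul_smul, Stream'.cons_append_stream, e_smul_cons, h, mul_assoc]

theorem exists_of_pathElt_smul_ne_zero (u : List (Fin n)) (φ : Chen K b ω₀)
    {ω : Stream' (Fin n)} (h : (pathElt K u • φ : Chen K b ω₀) ω ≠ 0) :
    ∃ ω', ω = u ++ₛ ω' ∧ φ ω' ≠ 0 := by
  induction u generalizing ω with
  | nil => exact ⟨ω, rfl, by simpa [pathElt_nil] using h⟩
  | cons i u ih =>
    rw [pathElt_cons, mul_smul, e_smul_apply] at h
    split_ifs at h with hi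
    · obtain ⟨ω', h1, h2⟩ := ih (right_ne_zero_of_mul h)
      refine ⟨ω', ?_, h2⟩
      rw [Stream'.cons_append_stream, ← h1, ← hi, Stream'.eta]
    · exact absurd rfl h

theorem ghostElt_smul (u : List (Fin n)) (ω : Stream' (Fin n)) :
    ∃ a : F, a ≠ 0 ∧ ∀ φ : Chen K b ω₀, (ghostElt K u • φ : Chen K b ω₀) ω = a * φ (u ++ₛ ω) := by
  induction u with
  | nil => exact ⟨1, one_ne_zero, fun φ => by simp [ghostElt]⟩
  | cons i u ih =>
    obtain ⟨a, ha, h⟩ := ih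
    refine ⟨a * (weight b ω₀ (Stream'.cons i (u ++ₛ ω)))⁻¹,
      mul_ne_zero ha (inv_ne_zero (weight_ne_zero _ _ _)), fun φ => ?_⟩
    rw [ghostElt_cons, mul_smul, h, es_smul_apply, Stream'.cons_append_stream, mul_assoc]

open Classical in
/-- The indicator function of the base word. -/
noncomputable def delta (K : Type*) [Field K] [Algebra K F] (b : Fˣ) (ω₀ : Stream' (Fin n)) :
    Chen K b ω₀ := fun ω => if ω = ω₀ then 1 else 0

theorem delta_apply_self : delta K b ω₀ ω₀ = 1 := if_pos rfl

theorem delta_apply_of_ne {ω : Stream' (Fin n)} (h : ω ≠ ω₀) : delta K b ω₀ ω = 0 := if_neg h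

theorem eq_smul_delta {φ : Chen K b ω₀} (h : ∀ ω, φ ω ≠ 0 → ω = ω₀) :
    φ = φ ω₀ • delta K b ω₀ := by
  ext ω
  rw [smul_apply]
  by_cases hω : ω = ω₀
  · rw [hω, delta_apply_self, mul_one]
  · rw [delta_apply_of_ne hω, mul_zero]
    exact by_contra fun h' => hω (h ω h')

/-- The functions with finite support, all of whose points end in the base word. -/
def finTail (K : Type*) [Field K] [Algebra K F] (b : Fˣ) (ω₀ : Stream' (Fin n)) :
    Submodule K (Chen K b ω₀) where
  carrier := {φ | {ω | φ ω ≠ 0}.Finite ∧ ∀ ω, φ ω ≠ 0 → ∃ s, ω = s ++ₛ ω₀}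
  zero_mem' := ⟨by simp [zero_apply], fun ω h => absurd rfl h⟩
  add_mem' := fun {φ ψ} hφ hψ => by
    have key : ∀ ω, (φ + ψ) ω ≠ 0 → φ ω ≠ 0 ∨ ψ ω ≠ 0 := by
      intro ω h
      by_contra! h'
      exact h (by rw [add_apply, h'.1, h'.2, add_zero])
    exact ⟨(hφ.1.union hψ.1).subset key, fun ω h => (key ω h).elim (hφ.2 ω) (hψ.2 ω)⟩
  smul_mem' := fun k φ hφ => by
    have key : ∀ ω, (k • φ) ω ≠ 0 → φ ω ≠ 0 := by
      intro ω h h'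
      exact h (show k • φ ω = 0 by rw [h', smul_zero])
    exact ⟨hφ.1.subset key, fun ω h => hφ.2 ω (key ω h)⟩

theorem delta_mem_finTail : delta K b ω₀ ∈ finTail K b ω₀ := by
  have key : ∀ ω, delta K b ω₀ ω ≠ 0 → ω = ω₀ := fun ω h =>
    by_contra fun h' => h (delta_apply_of_ne h')
  exact ⟨(Set.finite_singleton ω₀).subset key, fun ω h => ⟨[], key ω h⟩⟩

theorem smul_mem_finTail {d : List (Fin n)} (hd : d ≠ []) (hω₀ : d ++ₛ ω₀ = ω₀) (r : LPA K n)
    {φ : Chen K b ω₀} (hφ : φ ∈ finTail K b ω₀) : r • φ ∈ finTail K b ω₀ := by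
  refine smul_mem_of_edges _ (fun i φ hφ => ?_) (fun i φ hφ => ?_) r hφ
  · have key : ∀ ω, (e K i • φ : Chen K b ω₀) ω ≠ 0 → φ ω.tail ≠ 0 ∧ ω = Stream'.cons i ω.tail := by
      intro ω h
      rw [e_smul_apply] at h
      split_ifs at h with hi
      · exact ⟨right_ne_zero_of_mul h, by rw [← hi, Stream'.eta]⟩
      · exact absurd rfl h
    refine ⟨(hφ.1.image (Stream'.cons i)).subset fun ω h =>
      ⟨ω.tail, (key ω h).1, (key ω h).2.symm⟩, fun ω h => ?_⟩
    obtain ⟨s, hs⟩ := hφ.2 _ (key ω h).1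
    exact ⟨i :: s, by rw [Stream'.cons_append_stream, ← hs]; exact (key ω h).2⟩
  · have key : ∀ ω, (es K i • φ : Chen K b ω₀) ω ≠ 0 → φ (Stream'.cons i ω) ≠ 0 := by
      intro ω h
      rw [es_smul_apply] at h
      exact right_ne_zero_of_mul h
    refine ⟨(hφ.1.image Stream'.tail).subset fun ω h => ⟨_, key ω h, rfl⟩, fun ω h => ?_⟩
    obtain ⟨s, hs⟩ := hφ.2 _ (key ω h)
    -- The word `ω₀` itself also has a letter to delete before a copy of `ω₀`, since `ω₀ = d ω₀`.
    obtain ⟨s', hs', hne⟩ : ∃ s', Stream'.cons i ω = s' ++ₛ ω₀ ∧ s' ≠ [] := by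
      by_cases hs0 : s = []
      · exact ⟨d, by rw [hs, hs0, hω₀]; rfl, hd⟩
      · exact ⟨s, hs, hs0⟩
    cases s' with
    | nil => exact absurd rfl hne
    | cons j s' =>
      rw [Stream'.cons_append_stream] at hs'
      exact ⟨s', (Stream'.cons_injective2 hs').2⟩

/-- No weight `b` is met along a proper suffix of `d`: returning to `ω₀` would make a nonempty word
shorter than `d` a power of `d`. -/
theorem pathElt_smul_delta_of_suffix {d : List (Fin n)} (hd : IsSimpleClosedPath d)
    (hω₀ : d ++ₛ ω₀ = ω₀) {u v : List (Fin n)} (huv : d = u ++ v) (hu : u ≠ []) :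
    ∀ ω, (pathElt K v • delta K b ω₀ : Chen K b ω₀) (v ++ₛ ω) = delta K b ω₀ ω := by
  induction v generalizing u with
  | nil => simp [pathElt_nil]
  | cons i v ih =>
    intro ω
    rw [pathElt_cons, mul_smul, Stream'.cons_append_stream, e_smul_cons,
      ih (u := u ++ [i]) (by simp [huv]) (by simp)]
    by_cases hω : ω = ω₀
    · have hne : Stream'.cons i (v ++ₛ ω) ≠ ω₀ := by
        intro h
        rw [hω, ← Stream'.cons_append_stream] at h
        obtain ⟨k, hk⟩ := hd.exists_eq_pow_of_stream hω₀ h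
        have h1 := congrArg List.length hk
        have h2 := congrArg List.length huv
        rw [length_pow] at h1
        have h3 := List.length_pos_of_ne_nil hu
        simp only [List.length_cons, List.length_append] at h1 h2
        rcases k with _ | k
        · omega
        · nlinarith
      rw [weight, if_neg hne, one_mul]
    · rw [delta_apply_of_ne hω, mul_zero]

/-- The weight `b` is met exactly once, when the first letter of `d` closes the cycle. -/
theorem pathElt_smul_delta {d : List (Fin n)} (hd : IsSimpleClosedPath d) (hω₀ : d ++ₛ ω₀ = ω₀) :
    pathElt K d • delta K b ω₀ = (b : F) • delta K b ω₀ := by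
  have h1 : ∀ ω, (pathElt K d • delta K b ω₀ : Chen K b ω₀) ω ≠ 0 → ω = ω₀ := by
    intro ω h
    obtain ⟨ω', rfl, h2⟩ := exists_of_pathElt_smul_ne_zero _ _ h
    obtain rfl : ω' = ω₀ := by_contra fun h' => h2 (delta_apply_of_ne h')
    exact hω₀
  rw [eq_smul_delta h1]
  congr 1
  cases d with
  | nil => exact absurd rfl hd.1
  | cons i v =>
    rw [Stream'.cons_append_stream] at hω₀
    have h2 := e_smul_cons (K := K) (b := b) (ω₀ := ω₀) i (pathElt K v • delta K b ω₀) (v ++ₛ ω₀)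
    rw [pathElt_smul_delta_of_suffix hd (u := [i]) (v := v) (hω₀ := by
      rw [Stream'.cons_append_stream, hω₀]) rfl (by simp), hω₀, weight, if_pos rfl,
      delta_apply_self, mul_one] at h2
    rw [pathElt_cons, mul_smul, h2]

end Chen

/-- If `x` acts on `y` as the scalar `a`, then `π(x)` acts as `π(a)`. -/
theorem aeval_smul_of_smul_eq {K R F M : Type*} [Field K] [Ring R] [Algebra K R] [Field F]
    [Algebra K F] [AddCommGroup M] [Module K M] [Module R M] [Module F M] [IsScalarTower K R M]
    [IsScalarTower K F M] [SMulCommClass R F M] {x : R} {y : M} {a : F} (h : x • y = a • y)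
    (π : K[X]) : aeval x π • y = aeval a π • y := by
  induction π using Polynomial.induction_on' with
  | add p q hp hq => rw [map_add, map_add, add_smul, add_smul, hp, hq]
  | monomial k c =>
    have hk : ∀ k : ℕ, x ^ k • y = a ^ k • y := by
      intro k
      induction k with
      | zero => simp
      | succ k ih => rw [pow_succ', mul_smul, ih, smul_comm, h, ← mul_smul, ← pow_succ]
    rw [aeval_monomial, aeval_monomial, mul_smul, mul_smul, hk, algebraMap_smul, algebraMap_smul]

instance {K F : Type*} [Field K] [Field F] [Algebra K F] {n : ℕ} (b : Fˣ)
    (ω₀ : Stream' (Fin n)) : IsScalarTower K F (Chen K b ω₀) :=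
  inferInstanceAs (IsScalarTower K F (Stream' (Fin n) → F))

namespace Chen

variable {K F : Type*} [Field K] [Field F] [Algebra K F] {n : ℕ}
variable {b : Fˣ} {ω₀ : Stream' (Fin n)}

theorem aeval_pathElt_smul_delta {d : List (Fin n)} (hd : IsSimpleClosedPath d)
    (hω₀ : d ++ₛ ω₀ = ω₀) (π : K[X]) :
    aeval (pathElt K d) π • delta K b ω₀ = aeval (b : F) π • delta K b ω₀ :=
  aeval_smul_of_smul_eq (pathElt_smul_delta hd hω₀) π

end Chen

/-! ### Normal form in the cyclic module -/

section Cyclic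

variable {K : Type*} [Field K] {n : ℕ} {f : K[X]} {d : List (Fin n)}

/-- The generator `z` of `S^f_d`. -/
def gen (f : K[X]) (d : List (Fin n)) : S f d := Submodule.Quotient.mk 1

theorem smul_gen_eq_mk (r : LPA K n) : r • gen f d = Submodule.Quotient.mk r := by
  rw [gen, ← Submodule.Quotient.mk_smul, smul_eq_mul, mul_one]

theorem exists_smul_gen (y : S f d) : ∃ r : LPA K n, y = r • gen f d := by
  obtain ⟨r, rfl⟩ := Submodule.Quotient.mk_surjective _ y
  exact ⟨r, (smul_gen_eq_mk r).symm⟩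

theorem smul_gen_eq_zero_iff {r : LPA K n} :
    r • gen f d = 0 ↔ ∃ s, r = s * aeval (pathElt K d) f := by
  rw [smul_gen_eq_mk, Submodule.Quotient.mk_eq_zero, Submodule.mem_span_singleton]
  simp only [smul_eq_mul, eq_comm]

theorem aeval_mul_smul_gen (π : K[X]) : aeval (pathElt K d) (π * f) • gen f d = 0 :=
  smul_gen_eq_zero_iff.2 ⟨_, map_mul _ _ _⟩

theorem aeval_smul_gen_of_dvd {π : K[X]} (h : f ∣ π) : aeval (pathElt K d) π • gen f d = 0 := by
  obtain ⟨ρ, rfl⟩ := h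
  rw [mul_comm]
  exact aeval_mul_smul_gen ρ

/-- Constant term `1` makes `x` invertible modulo `f`, so a factor `d` can be pulled out in front,
ready for a ghost edge to act on. -/
theorem exists_aeval_smul_gen_eq (hf : f ∈ Irr K) (π : K[X]) :
    ∃ ρ : K[X], aeval (pathElt K d) π • gen f d =
      (pathElt K d * aeval (pathElt K d) ρ) • gen f d := by
  have h1 : π = π * f + X * -(π * divX f) := by
    conv_lhs => rw [← mul_one π]
    have h2 := divX_mul_X_add f
    rw [hf.2, C_1] at h2
    have h3 : (1 : K[X]) = f - divX f * X := by
      rw [eq_sub_iff_add_eq, add_comm, h2]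
    rw [h3]
    ring_nf
  refine ⟨-(π * divX f), ?_⟩
  conv_lhs => rw [h1, map_add, add_smul, aeval_mul_smul_gen, zero_add, map_mul, aeval_X]

/-- Words that do not end in `d`. -/
def IsReduced (d u : List (Fin n)) : Prop := ¬ d <:+ u

/-- The map sending a family of polynomials `π_u`, indexed by the reduced words `u`, to
`∑ u π_u(d) z`. -/
noncomputable def reducedSum (f : K[X]) (d : List (Fin n)) :
    ({u : List (Fin n) // IsReduced d u} →₀ K[X]) →ₗ[K] S f d :=
  Finsupp.lsum K fun u =>
    ((LinearMap.toSpanSingleton (LPA K n) (S f d) (gen f d)).restrictScalars K).comp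
    ((LinearMap.mulLeft K (pathElt K u.1)).comp (aeval (pathElt K d)).toLinearMap)

theorem reducedSum_single (u : {u : List (Fin n) // IsReduced d u}) (π : K[X]) :
    reducedSum f d (Finsupp.single u π) =
      (pathElt K u.1 * aeval (pathElt K d) π) • gen f d := by
  simp [reducedSum]

theorem reducedSum_apply (l : {u : List (Fin n) // IsReduced d u} →₀ K[X]) :
    reducedSum f d l =
      l.sum fun u π => (pathElt K u.1 * aeval (pathElt K d) π) • gen f d := by
  rw [reducedSum, Finsupp.lsum_apply]
  rfl

theorem isReduced_nil (hd : d ≠ []) : IsReduced d [] := fun h => hd (by simpa using h)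

/-- The range contains `z` and is stable under edges: a completed copy of `d` is absorbed into the
polynomial, and a ghost edge meeting the empty word first has a copy of `d` pulled out. -/
theorem reducedSum_surjective (hf : f ∈ Irr K) (hd : d ≠ []) :
    Function.Surjective (reducedSum f d) := by
  have mem : ∀ (u : List (Fin n)) (_ : IsReduced d u) (π : K[X]),
      (pathElt K u * aeval (pathElt K d) π) • gen f d ∈ (reducedSum f d).range :=
    fun u hu π => ⟨Finsupp.single ⟨u, hu⟩ π, reducedSum_single _ _⟩
  have hnil : ∀ π, aeval (pathElt K d) π • gen f d ∈ (reducedSum f d).range := fun π => by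
    simpa [pathElt_nil] using mem [] (isReduced_nil hd) π
  have he : ∀ i : Fin n, ∀ x ∈ (reducedSum f d).range, e K i • x ∈ (reducedSum f d).range := by
    rintro i _ ⟨l, rfl⟩
    induction l using Finsupp.induction_linear with
    | zero => simp
    | add l l' h h' =>
      rw [map_add, smul_add]
      exact Submodule.add_mem _ h h'
    | single u π =>
      rw [reducedSum_single, ← mul_smul, ← mul_assoc, ← pathElt_cons]
      by_cases h : IsReduced d (i :: u.1)
      · exact mem _ h π
      · rw [IsReduced, not_not, List.suffix_cons_iff] at h
        rcases h with h | h
        · rw [← h]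
          have h1 := hnil (X * π)
          rwa [map_mul, aeval_X] at h1
        · exact absurd h u.2
  have hes : ∀ i : Fin n, ∀ x ∈ (reducedSum f d).range, es K i • x ∈ (reducedSum f d).range := by
    rintro i _ ⟨l, rfl⟩
    have key : ∀ (j : Fin n) (u : List (Fin n)) (_ : IsReduced d u) (π : K[X]),
        es K i • (pathElt K (j :: u) * aeval (pathElt K d) π) • gen f d ∈
          (reducedSum f d).range := by
      intro j u hu π
      rw [← mul_smul, ← mul_assoc, pathElt_cons, ← mul_assoc, es_mul_e]
      split_ifs
      · rw [one_mul]
        exact mem _ hu π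
      · simp
    induction l using Finsupp.induction_linear with
    | zero => simp
    | add l l' h h' =>
      rw [map_add, smul_add]
      exact Submodule.add_mem _ h h'
    | single u π =>
      rw [reducedSum_single]
      obtain ⟨u, hu⟩ := u
      cases u with
      | nil =>
        obtain ⟨ρ, hρ⟩ := exists_aeval_smul_gen_eq (d := d) hf π
        rw [pathElt_nil, one_mul, hρ]
        cases d with
        | nil => exact absurd rfl hd
        | cons j d' =>
          exact key j d' (fun h => by simpa using h.length_le) ρ
      | cons j u => exact key j u (fun h => hu (h.trans (List.suffix_cons _ _))) π
  intro y
  obtain ⟨r, rfl⟩ := exists_smul_gen y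
  refine smul_mem_of_edges (reducedSum f d).range he hes r ?_
  simpa using hnil 1

/-- If `v = u t`, then `t` fixes `ω₀` and is a power of `d`; as `v` does not end in `d`, the
exponent is `0`. -/
theorem IsReduced.eq_of_stream (hd : IsSimpleClosedPath d) {ω₀ : Stream' (Fin n)}
    (hω₀ : d ++ₛ ω₀ = ω₀) {u v : List (Fin n)} (hu : IsReduced d u) (hv : IsReduced d v)
    (h : u ++ₛ ω₀ = v ++ₛ ω₀) : u = v := by
  wlog hl : u.length ≤ v.length generalizing u v
  · exact (this hv hu h.symm (by omega)).symm
  obtain ⟨t, rfl⟩ : ∃ t, v = u ++ t := by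
    refine ⟨v.drop u.length, ?_⟩
    have h1 := congrArg (Stream'.take u.length) h
    rw [Stream'.take_append_of_le_length _ _ _ le_rfl, Stream'.take_append_of_le_length _ _ _ hl,
      List.take_length] at h1
    conv_lhs => rw [← List.take_append_drop u.length v, ← h1]
  rw [Stream'.append_append_stream, Stream'.append_right_inj] at h
  obtain ⟨k, rfl⟩ := hd.exists_eq_pow_of_stream hω₀ h.symm
  cases k with
  | zero => simp
  | succ k =>
    refine absurd ?_ hv
    rw [List.replicate_succ', List.flatten_append, ← List.append_assoc, List.flatten_singleton]
    exact List.suffix_append _ _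

end Cyclic

/-- `b` is a generating root of `f`: the extension is `K[x]/(f)`, with `b` the class of `x`. -/
structure IsGeneratingRoot {K F : Type*} [Field K] [Field F] [Algebra K F] (f : K[X]) (b : F) :
    Prop where
  aeval_eq_zero_iff (π : K[X]) : aeval b π = 0 ↔ f ∣ π
  exists_aeval_eq (a : F) : ∃ π : K[X], aeval b π = a

theorem isGeneratingRoot_root {K : Type*} [Field K] (f : K[X]) [Fact (Irreducible f)] :
    IsGeneratingRoot f (AdjoinRoot.root f) where
  aeval_eq_zero_iff π := by rw [AdjoinRoot.aeval_eq, AdjoinRoot.mk_eq_zero]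
  exists_aeval_eq a := by
    obtain ⟨π, rfl⟩ := AdjoinRoot.mk_surjective a
    exact ⟨π, AdjoinRoot.aeval_eq π⟩

theorem root_ne_zero {K : Type*} [Field K] {f : K[X]} [Fact (Irreducible f)] (hf : f ∈ Irr K) :
    AdjoinRoot.root f ≠ 0 := by
  intro h
  have h1 : aeval (AdjoinRoot.root f) f = 0 :=
    ((isGeneratingRoot_root f).aeval_eq_zero_iff f).2 dvd_rfl
  rw [h, ← coeff_zero_eq_aeval_zero', hf.2, map_one] at h1
  exact one_ne_zero h1

/-! ### Embedding the cyclic module in the function model -/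

section Embedding

variable {K F : Type*} [Field K] [Field F] [Algebra K F] {n : ℕ} {f : K[X]} {d : List (Fin n)}
variable {b : Fˣ} {ω₀ : Stream' (Fin n)}

/-- The map from `S^f_d` to functions on infinite words that sends `z` to the indicator function
of `d^∞`. -/
noncomputable def toChen (hd : IsSimpleClosedPath d) (hω₀ : d ++ₛ ω₀ = ω₀)
    (hb : IsGeneratingRoot f (b : F)) : S f d →ₗ[LPA K n] Chen K b ω₀ :=
  Submodule.liftQ _ (LinearMap.toSpanSingleton (LPA K n) _ (Chen.delta K b ω₀)) (by
    rw [Submodule.span_le, Set.singleton_subset_iff, SetLike.mem_coe, LinearMap.mem_ker,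
      LinearMap.toSpanSingleton_apply, Chen.aeval_pathElt_smul_delta hd hω₀,
      (hb.aeval_eq_zero_iff f).2 dvd_rfl, zero_smul])

variable (hd : IsSimpleClosedPath d) (hω₀ : d ++ₛ ω₀ = ω₀) (hb : IsGeneratingRoot f (b : F))

theorem toChen_gen : toChen hd hω₀ hb (gen f d) = Chen.delta K b ω₀ := by
  rw [gen, toChen, Submodule.liftQ_apply, LinearMap.toSpanSingleton_apply, one_smul]

theorem toChen_aeval_smul_gen (π : K[X]) : toChen hd hω₀ hb (aeval (pathElt K d) π • gen f d) =
    aeval (b : F) π • Chen.delta K b ω₀ := by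
  rw [map_smul, toChen_gen, Chen.aeval_pathElt_smul_delta hd hω₀]

theorem toChen_mem_finTail (y : S f d) : toChen hd hω₀ hb y ∈ Chen.finTail K b ω₀ := by
  obtain ⟨r, rfl⟩ := exists_smul_gen y
  rw [map_smul, toChen_gen]
  exact Chen.smul_mem_finTail hd.1 hω₀ r Chen.delta_mem_finTail

/-- Distinct reduced words `u` give distinct points `u ω₀`, so the value there is a nonzero multiple
of `π_u(b)`. If it vanishes, `f` divides `π_u` and the term `u π_u(d) z` is zero. -/
theorem toChen_injective (hf : f ∈ Irr K) : Function.Injective (toChen hd hω₀ hb) := by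
  rw [← LinearMap.ker_eq_bot, LinearMap.ker_eq_bot']
  intro y hy
  obtain ⟨l, rfl⟩ := reducedSum_surjective hf hd.1 y
  have key : ∀ u, f ∣ l u := by
    intro u
    obtain ⟨a, ha, hau⟩ := Chen.pathElt_smul_append (K := K) (b := b) (ω₀ := ω₀) u.1 ω₀
    have h1 : ∀ v : {u : List (Fin n) // IsReduced d u},
        toChen hd hω₀ hb ((pathElt K v.1 * aeval (pathElt K d) (l v)) • gen f d) (u.1 ++ₛ ω₀) =
          if v = u then aeval (b : F) (l u) * a else 0 := by
      intro v
      rw [mul_smul, map_smul, toChen_aeval_smul_gen, smul_comm, Chen.smul_apply]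
      split_ifs with h
      · rw [h, hau, Chen.delta_apply_self, mul_one]
      · by_contra h0
        obtain ⟨ω', h2, h3⟩ := Chen.exists_of_pathElt_smul_ne_zero _ _ (right_ne_zero_of_mul h0)
        obtain rfl : ω' = ω₀ := by_contra fun h' => h3 (Chen.delta_apply_of_ne h')
        exact h (Subtype.ext (v.2.eq_of_stream hd hω₀ u.2 h2.symm))
    let ev : Chen K b ω₀ →+ F :=
      { toFun := fun φ => φ (u.1 ++ₛ ω₀)
        map_zero' := rfl
        map_add' := fun _ _ => rfl }
    have h2 : ev (toChen hd hω₀ hb (reducedSum f d l)) = 0 := by rw [hy]; rfl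
    rw [reducedSum_apply, Finsupp.sum, map_sum, map_sum] at h2
    have h3 : ∑ v ∈ l.support, (if v = u then aeval (b : F) (l u) * a else 0) = 0 :=
      (Finset.sum_congr rfl fun v _ => (h1 v).symm).trans h2
    rw [Finset.sum_ite_eq'] at h3
    split_ifs at h3 with h4
    · rw [← hb.aeval_eq_zero_iff]
      exact (mul_eq_zero.1 h3).resolve_right ha
    · rw [Finsupp.notMem_support_iff.1 h4]
      exact dvd_zero f
  rw [reducedSum_apply]
  refine Finset.sum_eq_zero fun u _ => ?_
  change (_ * _) • gen f d = 0
  rw [mul_smul, aeval_smul_gen_of_dvd (key u), smul_zero]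

end Embedding

/-! ### Simplicity of the untwisted modules -/

section Simple

variable {K F : Type*} [Field K] [Field F] [Algebra K F] {n : ℕ}
variable {f g : K[X]} {c d : List (Fin n)}
variable {b : Fˣ} {ω₀ : Stream' (Fin n)}

theorem Chen.exists_ghostElt_smul_eq_smul_delta (hd : d ≠ []) (hω₀ : d ++ₛ ω₀ = ω₀)
    {φ : Chen K b ω₀} (hφ : φ ∈ Chen.finTail K b ω₀) (h0 : φ ≠ 0) :
    ∃ (u : List (Fin n)) (a : F), a ≠ 0 ∧ ghostElt K u • φ = a • Chen.delta K b ω₀ := by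
  obtain ⟨ω, hω⟩ : ∃ ω, φ ω ≠ 0 := by
    by_contra! h
    exact h0 (Chen.ext h)
  obtain ⟨s, rfl⟩ := hφ.2 ω hω
  have hpow := fun k => pow_append_stream hω₀ k
  -- The support is finite, so for large `k` its only point with prefix `s d^k` is `s ω₀`; the ghost
  -- path of that prefix removes all others.
  have hev : ∀ᶠ k in Filter.atTop, ∀ σ ∈ {σ | φ σ ≠ 0}, ∀ ω',
      σ = (s ++ (List.replicate k d).flatten) ++ₛ ω' → ω' = ω₀ := by
    rw [Filter.eventually_all_finite hφ.1]
    intro σ _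
    by_cases hσ : σ = s ++ₛ ω₀
    · refine Filter.Eventually.of_forall fun k ω' h => ?_
      rw [hσ, Stream'.append_append_stream, Stream'.append_right_inj] at h
      rw [← hpow k, Stream'.append_right_inj] at h
      exact h.symm
    · obtain ⟨m, hm⟩ : ∃ m, σ.get m ≠ (s ++ₛ ω₀).get m := by
        by_contra! h
        exact hσ (Stream'.ext h)
      filter_upwards [Filter.eventually_gt_atTop m] with k hk ω' h
      refine absurd ?_ hm
      have hl : m < (s ++ (List.replicate k d).flatten).length := by
        rw [List.length_append, length_pow]
        have := List.length_pos_of_ne_nil hd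
        nlinarith
      rw [h, ← hpow k, ← Stream'.append_append_stream, Stream'.get_append_left _ _ _ hl,
        Stream'.get_append_left _ _ _ hl]
  obtain ⟨k, hk⟩ := hev.exists
  set u := s ++ (List.replicate k d).flatten with hu
  have h1 : ∀ ω', (ghostElt K u • φ : Chen K b ω₀) ω' ≠ 0 → ω' = ω₀ := by
    intro ω' h
    obtain ⟨a, -, ha⟩ := Chen.ghostElt_smul (K := K) (b := b) (ω₀ := ω₀) u ω'
    rw [ha] at h
    exact hk _ (right_ne_zero_of_mul h) ω' rfl
  refine ⟨u, _, ?_, Chen.eq_smul_delta h1⟩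
  obtain ⟨a, ha0, ha⟩ := Chen.ghostElt_smul (K := K) (b := b) (ω₀ := ω₀) u ω₀
  rw [ha, hu, Stream'.append_append_stream, hpow]
  exact mul_ne_zero ha0 hω

theorem gen_ne_zero (hf : f ∈ Irr K) (hd : IsSimpleClosedPath d) : gen f d ≠ 0 := by
  have := Fact.mk hf.1
  have hω₀ := (Stream'.cycle_eq d hd.1).symm
  intro h
  have h1 := toChen_gen hd hω₀ (b := Units.mk0 _ (root_ne_zero hf)) (isGeneratingRoot_root f)
  rw [h, map_zero] at h1
  have h2 := congrFun h1 (Stream'.cycle d hd.1)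
  rw [Chen.delta_apply_self] at h2
  exact zero_ne_one h2

/-- A ghost path brings `y` to `a δ`. Since `a⁻¹ = π(b)` for some `π`, the element `π(d)` removes
the scalar. -/
theorem exists_smul_eq_gen (hf : f ∈ Irr K) (hd : IsSimpleClosedPath d) {y : S f d}
    (hy : y ≠ 0) : ∃ r : LPA K n, r • y = gen f d := by
  have := Fact.mk hf.1
  have hω₀ := (Stream'.cycle_eq d hd.1).symm
  have hb : IsGeneratingRoot f ((Units.mk0 _ (root_ne_zero hf) : (AdjoinRoot f)ˣ) : AdjoinRoot f) :=
    isGeneratingRoot_root f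
  have hinj := toChen_injective hd hω₀ hb hf
  obtain ⟨u, a, ha, h⟩ := Chen.exists_ghostElt_smul_eq_smul_delta hd.1 hω₀
    (toChen_mem_finTail hd hω₀ hb y) ((map_ne_zero_iff _ hinj).2 hy)
  obtain ⟨π, hπ⟩ := hb.exists_aeval_eq a⁻¹
  refine ⟨aeval (pathElt K d) π * ghostElt K u, hinj ?_⟩
  rw [map_smul, mul_smul, h, smul_comm, Chen.aeval_pathElt_smul_delta hd hω₀, hπ, ← mul_smul,
    mul_inv_cancel₀ ha, one_smul, toChen_gen]

theorem isSimpleModule_S (hf : f ∈ Irr K) (hd : IsSimpleClosedPath d) :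
    IsSimpleModule (LPA K n) (S f d) := by
  rw [isSimpleModule_iff_toSpanSingleton_surjective]
  refine ⟨⟨gen f d, 0, gen_ne_zero hf hd⟩, fun y hy x => ?_⟩
  obtain ⟨r, hr⟩ := exists_smul_eq_gen hf hd hy
  obtain ⟨s, rfl⟩ := exists_smul_gen x
  exact ⟨s * r, by rw [LinearMap.toSpanSingleton_apply, mul_smul, hr]⟩

end Simple

/-! ### Functions killed by `f(w(e_j - e_i t))` -/

section Orbit

variable {K F : Type*} [Field K] [Field F] [Algebra K F] {n : ℕ}
variable {f g : K[X]} {c d : List (Fin n)}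
variable {b : Fˣ} {ω₀ : Stream' (Fin n)} {w : List (Fin n)} {i j : Fin n}

/-- The function `e_i t φ` lives on words beginning with `i`, so it cannot cancel `e_j φ` at `j ω`.
-/
theorem Chen.smul_append_ne_zero (hij : i ≠ j) (t : LPA K n) {φ : Chen K b ω₀}
    {ω : Stream' (Fin n)} (h : φ ω ≠ 0) :
    ((pathElt K w * (e K j - e K i * t)) • φ : Chen K b ω₀) ((w ++ [j]) ++ₛ ω) ≠ 0 := by
  obtain ⟨a, ha, h1⟩ := Chen.pathElt_smul_append (K := K) (b := b) (ω₀ := ω₀) w ([j] ++ₛ ω)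
  rw [mul_smul, Stream'.append_append_stream, h1, sub_smul, mul_smul, Chen.sub_apply]
  refine mul_ne_zero ha ?_
  rw [Stream'.cons_append_stream, Stream'.nil_append_stream, Chen.e_smul_cons,
    Chen.e_smul_cons_of_ne hij.symm, sub_zero]
  exact mul_ne_zero (weight_ne_zero _ _ _) h

theorem Chen.append_eq_of_aeval_smul_eq_zero (hf : f ∈ Irr K) (hd : d ≠ [])
    (hω₀ : d ++ₛ ω₀ = ω₀) (hij : i ≠ j) (t : LPA K n) {φ : Chen K b ω₀}
    (hφ : φ ∈ Chen.finTail K b ω₀)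
    (h : aeval (pathElt K w * (e K j - e K i * t)) f • φ = 0) {ω : Stream' (Fin n)}
    (hω : φ ω ≠ 0) : (w ++ [j]) ++ₛ ω = ω := by
  set x := pathElt K w * (e K j - e K i * t) with hx
  set u := w ++ [j] with hu
  have hu0 : u ≠ [] := by simp [hu]
  have hΩ : (⋃ k ∈ Finset.range (f.natDegree + 1),
      {ω | (x ^ k • φ : Chen K b ω₀) ω ≠ 0}).Finite :=
    (Finset.finite_toSet _).biUnion fun k _ => (Chen.smul_mem_finTail hd hω₀ (x ^ k) hφ).1
  have hpow : ∀ k, (x ^ k • φ : Chen K b ω₀) ((List.replicate k u).flatten ++ₛ ω) ≠ 0 := by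
    intro k
    induction k with
    | zero => simpa using hω
    | succ k ih =>
      rw [pow_succ', mul_smul, List.replicate_succ, List.flatten_cons,
        Stream'.append_append_stream]
      exact Chen.smul_append_ne_zero hij t ih
  have hmem : ∀ k, (List.replicate k u).flatten ++ₛ ω ∈
      ⋃ k ∈ Finset.range (f.natDegree + 1), {ω | (x ^ k • φ : Chen K b ω₀) ω ≠ 0} := by
    intro k
    have h1 := hpow k
    -- Reducing `X^k` modulo `f` puts every `x^k φ` in the span of finitely many, hence all supports
    -- in one finite set.
    have h2 : x ^ k • φ = aeval x (X ^ k % f : K[X]) • φ := by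
      conv_lhs => rw [← aeval_X (R := K) x, ← map_pow, ← EuclideanDomain.mod_add_div (X ^ k) f,
        mul_comm f, map_add, map_mul, add_smul, mul_smul, h, smul_zero, add_zero]
    have hdeg : (X ^ k % f : K[X]).natDegree < f.natDegree + 1 :=
      (natDegree_mod_lt _ hf.1.natDegree_pos.ne').trans (Nat.lt_succ_self _)
    rw [h2, aeval_eq_sum_range' hdeg, Finset.sum_smul] at h1
    have h3 : ∑ m ∈ Finset.range (f.natDegree + 1),
        (((X ^ k % f : K[X]).coeff m • x ^ m) • φ : Chen K b ω₀)
          ((List.replicate k u).flatten ++ₛ ω) ≠ 0 := by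
      intro h0
      exact h1 ((Finset.sum_apply _ _ _).trans h0)
    obtain ⟨m, hm, h4⟩ := Finset.exists_ne_zero_of_sum_ne_zero h3
    refine Set.mem_biUnion hm fun h5 => h4 ?_
    rw [smul_assoc]
    change (X ^ k % f : K[X]).coeff m •
      (x ^ m • φ : Chen K b ω₀) ((List.replicate k u).flatten ++ₛ ω) = 0
    rw [h5, smul_zero]
  have hninj : ¬ Function.Injective fun k => (List.replicate k u).flatten ++ₛ ω :=
    fun hinj => Set.infinite_of_injective_forall_mem hinj hmem hΩ
  obtain ⟨k, l, hkl, hne⟩ : ∃ k l, (List.replicate k u).flatten ++ₛ ω =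
      (List.replicate l u).flatten ++ₛ ω ∧ k < l := by
    simp only [Function.Injective, not_forall] at hninj
    obtain ⟨k, l, h1, h2⟩ := hninj
    rcases lt_or_gt_of_ne h2 with h3 | h3
    · exact ⟨k, l, h1, h3⟩
    · exact ⟨l, k, h1.symm, h3⟩
  obtain ⟨m, rfl⟩ := Nat.exists_eq_add_of_lt hne
  rw [add_assoc, List.replicate_add, List.flatten_append, Stream'.append_append_stream,
    Stream'.append_right_inj] at hkl
  have h1 := (Stream'.cycle_eq u hu0).symm
  have h2 : ω = Stream'.cycle u hu0 :=
    eq_of_append_stream_eq (u := (List.replicate (m + 1) u).flatten)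
      (by simp [List.replicate_succ, hu0]) hkl.symm (pow_append_stream h1 _)
  rw [h2, h1]

theorem Chen.smul_eq_zero_of_aeval_smul_eq_zero (hf : f ∈ Irr K) (hd : d ≠ [])
    (hω₀ : d ++ₛ ω₀ = ω₀) (hij : i ≠ j) (t : LPA K n) {φ : Chen K b ω₀}
    (hφ : φ ∈ Chen.finTail K b ω₀)
    (h : aeval (pathElt K w * (e K j - e K i * t)) f • φ = 0) : t • φ = 0 := by
  set x := pathElt K w * (e K j - e K i * t) with hx
  ext ω
  rw [Chen.zero_apply]
  by_contra hω
  -- `xφ` is killed by `f(x)` too, so its support consists of words beginning with `w j`. A point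
  -- `ω` with `(tφ)(ω) ≠ 0` would add `w i ω` to it.
  have h1 : aeval x f • (x • φ) = 0 := by
    have h0 := congrArg (aeval x) (mul_comm f X)
    rw [map_mul, map_mul, aeval_X] at h0
    rw [← mul_smul, h0, mul_smul, h, smul_zero]
  have h2 : (x • φ : Chen K b ω₀) (w ++ₛ Stream'.cons i ω) ≠ 0 := by
    obtain ⟨a, ha, h3⟩ :=
      Chen.pathElt_smul_append (K := K) (b := b) (ω₀ := ω₀) w (Stream'.cons i ω)
    rw [hx, mul_smul, h3, sub_smul, mul_smul, Chen.sub_apply, Chen.e_smul_cons,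
      Chen.e_smul_cons_of_ne hij, zero_sub]
    exact mul_ne_zero ha (neg_ne_zero.2 (mul_ne_zero (weight_ne_zero _ _ _) hω))
  have h3 := Chen.append_eq_of_aeval_smul_eq_zero hf hd hω₀ hij t
    (Chen.smul_mem_finTail hd hω₀ x hφ) h1 h2
  rw [Stream'.append_append_stream, Stream'.append_right_inj, Stream'.cons_append_stream] at h3
  exact hij (Stream'.cons_injective2 h3).1.symm

theorem Irr.eq_of_dvd (hf : f ∈ Irr K) (hg : g ∈ Irr K) (h : g ∣ f) : f = g := by
  obtain ⟨u, hu⟩ := hg.1.associated_of_dvd hf.1 h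
  obtain ⟨a, -, ha⟩ := isUnit_iff.1 u.isUnit
  rw [← ha] at hu
  have h1 := hf.2
  rw [← hu, mul_coeff_zero, hg.2, coeff_C_zero, one_mul] at h1
  rw [← hu, h1, C_1, mul_one]

theorem mem_rotations_and_of_aeval_smul_eq_zero (hf : f ∈ Irr K) (hg : g ∈ Irr K)
    (hc : IsSimpleClosedPath (w ++ [j])) (hd : IsSimpleClosedPath d) (hij : i ≠ j) {t : LPA K n}
    {y : S g d} (hy : y ≠ 0) (h : aeval (pathElt K w * (e K j - e K i * t)) f • y = 0) :
    d ∈ rotations (w ++ [j]) ∧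
      (w ++ [j] = d → f = g ∧ ∃ r, t = r * aeval (pathElt K (w ++ [j])) f) := by
  have := Fact.mk hg.1
  have hω₀ := (Stream'.cycle_eq d hd.1).symm
  have hb : IsGeneratingRoot g ((Units.mk0 _ (root_ne_zero hg) : (AdjoinRoot g)ˣ) : AdjoinRoot g) :=
    isGeneratingRoot_root g
  have hinj := toChen_injective hd hω₀ hb hg
  set φ := toChen hd hω₀ hb y with hφ
  have hφ0 : φ ≠ 0 := (map_ne_zero_iff _ hinj).2 hy
  have hφm := toChen_mem_finTail hd hω₀ hb y
  rw [← hφ] at hφm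
  have hx : aeval (pathElt K w * (e K j - e K i * t)) f • φ = 0 := by
    rw [hφ, ← map_smul, h, map_zero]
  have hsupp := fun ω => Chen.append_eq_of_aeval_smul_eq_zero hf hd.1 hω₀ hij t hφm hx (ω := ω)
  have ht := Chen.smul_eq_zero_of_aeval_smul_eq_zero hf hd.1 hω₀ hij t hφm hx
  constructor
  · obtain ⟨ω, hω⟩ : ∃ ω, φ ω ≠ 0 := by
      by_contra! h
      exact hφ0 (Chen.ext h)
    obtain ⟨s, hs⟩ := hφm.2 ω hω
    exact mem_rotations_of_stream hc hd (hsupp ω hω) hω₀ s hs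
  · intro hcd
    have hφδ := Chen.eq_smul_delta (φ := φ) fun ω hω =>
      eq_of_append_stream_eq hc.1 (hsupp ω hω) (by rw [hcd, hω₀])
    set a := φ (Stream'.cycle d hd.1)
    have ha : a ≠ 0 := fun h0 => hφ0 (by rw [hφδ, h0, zero_smul])
    -- As `tφ = 0`, `x` acts on `φ = a δ` as `d` does, namely as the root `b` of `g`.
    have hcφ : (pathElt K w * (e K j - e K i * t)) • φ =
        ((Units.mk0 _ (root_ne_zero hg) : (AdjoinRoot g)ˣ) : AdjoinRoot g) • φ := by
      rw [mul_sub, sub_smul, ← mul_assoc, mul_smul _ t, ht, smul_zero, sub_zero]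
      have h1 : pathElt K w * e K j = pathElt K d := by
        rw [← hcd, pathElt_append, pathElt_cons, pathElt_nil, mul_one]
      rw [h1, hφδ, smul_comm, Chen.pathElt_smul_delta hd hω₀, smul_comm]
    have hfg : f = g := by
      refine Irr.eq_of_dvd hf hg ((hb.aeval_eq_zero_iff f).1 ?_)
      rw [aeval_smul_of_smul_eq hcφ] at hx
      exact (smul_eq_zero.1 hx).resolve_right hφ0
    refine ⟨hfg, ?_⟩
    rw [hfg, hcd]
    refine smul_gen_eq_zero_iff.1 (hinj ?_)
    rw [map_zero, map_smul, toChen_gen]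
    rw [hφδ, smul_comm] at ht
    exact (smul_eq_zero.1 ht).resolve_left ha

end Orbit

/-! ### Isomorphisms out of a simple cyclic module -/

section QuotientByElement

variable {R : Type*} [Ring R]

/-- Maps from `R/Rx` are elements killed by `x`; by Schur's lemma a nonzero one is an isomorphism.
-/
theorem nonempty_quotient_span_equiv_iff {N : Type*} [AddCommGroup N] [Module R N] {x : R}
    [IsSimpleModule R (R ⧸ Submodule.span R {x})] [IsSimpleModule R N] :
    Nonempty ((R ⧸ Submodule.span R {x}) ≃ₗ[R] N) ↔ ∃ y : N, y ≠ 0 ∧ x • y = 0 := by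
  constructor
  · rintro ⟨θ⟩
    have h1 : ∀ r : R, r • θ (Submodule.Quotient.mk 1) = θ (Submodule.Quotient.mk r) := fun r => by
      rw [← map_smul, ← Submodule.Quotient.mk_smul, smul_eq_mul, mul_one]
    refine ⟨θ (Submodule.Quotient.mk 1), fun h => ?_, ?_⟩
    · have := IsSimpleModule.nontrivial R (R ⧸ Submodule.span R {x})
      obtain ⟨z, hz⟩ := exists_ne (0 : R ⧸ Submodule.span R {x})
      obtain ⟨r, rfl⟩ := Submodule.Quotient.mk_surjective _ z
      refine hz (θ.injective ?_)
      rw [← h1, h, smul_zero, map_zero]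
    · rw [h1, (Submodule.Quotient.mk_eq_zero _).2 (Submodule.mem_span_singleton_self x), map_zero]
  · rintro ⟨y, hy, hxy⟩
    let θ : (R ⧸ Submodule.span R {x}) →ₗ[R] N :=
      Submodule.liftQ _ (LinearMap.toSpanSingleton R N y) (by
        rw [Submodule.span_le, Set.singleton_subset_iff]
        exact hxy)
    have hθ : θ ≠ 0 := by
      intro h
      have h1 : θ (Submodule.Quotient.mk 1) = y := by simp [θ]
      exact hy (by rw [← h1, h, LinearMap.zero_apply])
    exact ⟨LinearEquiv.ofBijective θ (LinearMap.bijective_of_ne_zero hθ)⟩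

end QuotientByElement

/-! ### Twisting by an automorphism -/

section Twist

variable {K R : Type*} [Field K] [Ring R] [Algebra K R] (σ : R ≃ₐ[K] R)

theorem isSimpleModule_twist {M : Type*} [AddCommGroup M] [Module R M] [IsSimpleModule R M] :
    IsSimpleModule R (Twist σ M) := by
  have h := isSimpleModule_iff_toSpanSingleton_surjective.1 ‹IsSimpleModule R M›
  rw [isSimpleModule_iff_toSpanSingleton_surjective]
  refine ⟨h.1, fun y hy x => ?_⟩
  obtain ⟨r, hr⟩ := h.2 y hy x
  refine ⟨σ.symm r, ?_⟩
  change σ (σ.symm r) • (show M from y) = x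
  rw [AlgEquiv.apply_symm_apply]
  exact hr

/-- The map sending `r` to the class of `σ(r)` is linear for the twisted action, with kernel `R
σ⁻¹(x)`. -/
theorem nonempty_twist_quotient_equiv (x : R) :
    Nonempty (Twist σ (R ⧸ Submodule.span R {x}) ≃ₗ[R] R ⧸ Submodule.span R {σ.symm x}) := by
  let θ : R →ₗ[R] Twist σ (R ⧸ Submodule.span R {x}) :=
    LinearMap.toSpanSingleton R _ (show R ⧸ Submodule.span R {x} from Submodule.Quotient.mk 1)
  have hθ : ∀ r, θ r = (Submodule.Quotient.mk (σ r) : R ⧸ Submodule.span R {x}) := by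
    intro r
    change σ r • (Submodule.Quotient.mk 1 : R ⧸ Submodule.span R {x}) = _
    rw [← Submodule.Quotient.mk_smul, smul_eq_mul, mul_one]
  have hs : Function.Surjective θ := by
    intro y
    obtain ⟨r, hr⟩ := Submodule.Quotient.mk_surjective (Submodule.span R {x}) y
    exact ⟨σ.symm r, by rw [hθ, AlgEquiv.apply_symm_apply]; exact hr⟩
  have hk : Submodule.span R {σ.symm x} = LinearMap.ker θ := by
    ext r
    rw [LinearMap.mem_ker, hθ]
    refine Iff.trans ?_ (Submodule.Quotient.mk_eq_zero _).symm
    rw [Submodule.mem_span_singleton, Submodule.mem_span_singleton]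
    constructor
    · rintro ⟨s, rfl⟩
      exact ⟨σ s, by simp⟩
    · rintro ⟨s, hs⟩
      exact ⟨σ.symm s, by rw [smul_eq_mul, ← map_mul, ← smul_eq_mul, hs, AlgEquiv.symm_apply_apply]⟩
  exact ⟨((Submodule.quotEquivOfEq _ _ hk).trans (θ.quotKerEquivOfSurjective hs)).symm⟩

/-- A module and its twist have the same endomorphisms. -/
def endTwistEquiv (M : Type*) [AddCommGroup M] [Module R M] [Module K M] [IsScalarTower K R M] :
    Module.End R (Twist σ M) ≃ₐ[K] Module.End R M where
  toFun φ :=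
    { toFun := fun y => φ y
      map_add' := fun x y => map_add φ x y
      map_smul' := fun r y => by
        let φ' : M → M := φ
        have h : ∀ s : R, φ' (σ s • y) = σ s • φ' y := fun s => LinearMap.map_smul φ s y
        have hr := h (σ.symm r)
        rw [AlgEquiv.apply_symm_apply] at hr
        exact hr }
  invFun φ :=
    { toFun := fun y => φ y
      map_add' := fun x y => map_add φ x y
      map_smul' := fun r y => LinearMap.map_smul φ (σ r) y }
  left_inv _ := rfl
  right_inv _ := rfl
  map_mul' _ _ := rfl
  map_add' _ _ := rfl
  commutes' _ := rfl

end Twist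

/-! ### Endomorphism algebras -/

section Endomorphisms

variable {K : Type*} [Field K] {n : ℕ} {f : K[X]} {c : List (Fin n)}

/-- The endomorphism of `S^f_c` that sends `z` to `c z`. -/
def pathEnd (f : K[X]) (c : List (Fin n)) : Module.End (LPA K n) (S f c) :=
  Submodule.liftQ _ (LinearMap.toSpanSingleton (LPA K n) (S f c) (pathElt K c • gen f c)) (by
    rw [Submodule.span_le, Set.singleton_subset_iff, SetLike.mem_coe, LinearMap.mem_ker,
      LinearMap.toSpanSingleton_apply, ← mul_smul]
    have h := aeval_mul_smul_gen (f := f) (d := c) X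
    rwa [mul_comm, map_mul, aeval_X] at h)

theorem pathEnd_gen : pathEnd f c (gen f c) = pathElt K c • gen f c := by
  change pathEnd f c (Submodule.Quotient.mk 1) = _
  rw [pathEnd, Submodule.liftQ_apply, LinearMap.toSpanSingleton_apply, one_smul]

theorem aeval_pathEnd_gen (π : K[X]) :
    aeval (pathEnd f c) π (gen f c) = aeval (pathElt K c) π • gen f c := by
  induction π using Polynomial.induction_on' with
  | add p q hp hq => rw [map_add, map_add, add_smul, LinearMap.add_apply, hp, hq]
  | monomial k a =>
    have hk : ∀ k : ℕ, (pathEnd f c ^ k) (gen f c) = pathElt K c ^ k • gen f c := by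
      intro k
      induction k with
      | zero => simp
      | succ k ih =>
        rw [pow_succ', Module.End.mul_apply, ih, map_smul, pathEnd_gen, ← mul_smul, ← pow_succ]
    rw [aeval_monomial, aeval_monomial, Module.End.mul_apply, hk, mul_smul]
    rw [Module.algebraMap_end_apply, algebraMap_smul]

theorem end_ext {φ ψ : Module.End (LPA K n) (S f c)} (h : φ (gen f c) = ψ (gen f c)) : φ = ψ := by
  refine LinearMap.ext fun y => ?_
  obtain ⟨r, rfl⟩ := exists_smul_gen y
  rw [map_smul, map_smul, h]

theorem nonempty_end_equiv (hf : f ∈ Irr K) {w : List (Fin n)} {i j : Fin n} (hij : i ≠ j)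
    (hc : IsSimpleClosedPath (w ++ [j])) :
    Nonempty (Module.End (LPA K n) (S f (w ++ [j])) ≃ₐ[K] K[X] ⧸ Ideal.span {f}) := by
  have := Fact.mk hf.1
  have hω₀ := (Stream'.cycle_eq _ hc.1).symm
  have hb : IsGeneratingRoot f ((Units.mk0 _ (root_ne_zero hf) : (AdjoinRoot f)ˣ) : AdjoinRoot f) :=
    isGeneratingRoot_root f
  have hinj := toChen_injective hc hω₀ hb hf
  -- With `t = 0` the support lemma says that an element killed by `f(c)` maps to a multiple `π(b)
  -- δ`, so each endomorphism is a polynomial in `pathEnd`.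
  have hw : pathElt K w * (e K j - e K i * 0) = pathElt K (w ++ [j]) := by
    rw [mul_zero, sub_zero, pathElt_append, pathElt_cons, pathElt_nil, mul_one]
  have hs : Function.Surjective (aeval (R := K) (pathEnd f (w ++ [j]))) := by
    intro φ
    have h0 : aeval (pathElt K w * (e K j - e K i * 0)) f • toChen hc hω₀ hb (φ (gen f _)) = 0 := by
      rw [hw, ← map_smul, ← map_smul, aeval_smul_gen_of_dvd dvd_rfl, map_zero, map_zero]
    have h1 := Chen.eq_smul_delta (φ := toChen hc hω₀ hb (φ (gen f _))) fun ω hω =>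
      eq_of_append_stream_eq hc.1 (Chen.append_eq_of_aeval_smul_eq_zero hf hc.1 hω₀ hij 0
        (toChen_mem_finTail hc hω₀ hb _) h0 hω) hω₀
    obtain ⟨π, hπ⟩ := hb.exists_aeval_eq (toChen hc hω₀ hb (φ (gen f _)) (Stream'.cycle _ hc.1))
    refine ⟨π, end_ext (hinj ?_)⟩
    rw [aeval_pathEnd_gen, toChen_aeval_smul_gen, hπ, ← h1]
  have hk : RingHom.ker (aeval (R := K) (pathEnd f (w ++ [j]))) = Ideal.span {f} := by
    ext π
    rw [RingHom.mem_ker, Ideal.mem_span_singleton]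
    refine ⟨fun h => ?_, fun h => end_ext ?_⟩
    · have h1 := toChen_aeval_smul_gen hc hω₀ hb π
      rw [← aeval_pathEnd_gen, h, LinearMap.zero_apply, map_zero] at h1
      have h2 := congrFun h1 (Stream'.cycle _ hc.1)
      rw [Chen.smul_apply, Chen.delta_apply_self, mul_one] at h2
      exact (hb.aeval_eq_zero_iff π).1 h2.symm
    · rw [aeval_pathEnd_gen, aeval_smul_gen_of_dvd h, LinearMap.zero_apply]
  exact ⟨((Ideal.quotientEquivAlgOfEq K hk.symm).trans
    (Ideal.quotientKerAlgEquivOfSurjective hs)).symm⟩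

end Endomorphisms

/-! ### Isomorphism criteria -/

section Isomorphisms

variable {K : Type*} [Field K] {n : ℕ} {f : K[X]} {c d : List (Fin n)}

/-- Since `f(c)` commutes with `c`, a multiple `t = r f(c)` kills every `c^k z`, and the
perturbation by `t` is invisible on `z`. This gives the sufficiency of the divisibility conditions.
-/
theorem aeval_smul_gen_eq {w : List (Fin n)} {i j : Fin n} (r : LPA K n) (π : K[X]) :
    aeval (pathElt K w * (e K j - e K i * (r * aeval (pathElt K (w ++ [j])) f))) π •
        gen f (w ++ [j]) = aeval (pathElt K (w ++ [j])) π • gen f (w ++ [j]) := by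
  set x := pathElt K w * (e K j - e K i * (r * aeval (pathElt K (w ++ [j])) f)) with hx
  induction π using Polynomial.induction_on' with
  | add p q hp hq => rw [map_add, map_add, add_smul, add_smul, hp, hq]
  | monomial k a =>
    have hk : ∀ k : ℕ, x ^ k • gen f (w ++ [j]) =
        pathElt K (w ++ [j]) ^ k • gen f (w ++ [j]) := by
      intro k
      induction k with
      | zero => simp
      | succ k ih =>
        have h0 := aeval_mul_smul_gen (f := f) (d := w ++ [j]) (X ^ k)
        rw [mul_comm, map_mul, map_pow, aeval_X, mul_smul] at h0
        rw [pow_succ', mul_smul, ih, hx, mul_smul, sub_smul, mul_smul (e K i), mul_smul r, h0,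
          smul_zero, smul_zero, sub_zero, ← mul_smul (pathElt K w), pow_succ',
          mul_smul (pathElt K (w ++ [j]))]
        refine congrArg (· • _) ?_
        rw [pathElt_append, pathElt_cons, pathElt_nil, mul_one]
    rw [aeval_monomial, aeval_monomial, mul_smul, mul_smul, hk]

theorem nonempty_equiv_of_mem_rotations (hf : f ∈ Irr K) (hc : IsSimpleClosedPath c)
    (h : d ∈ rotations c) : Nonempty (S f d ≃ₗ[LPA K n] S f c) := by
  have hd : IsSimpleClosedPath d := by
    obtain ⟨k, rfl⟩ := h
    exact hc.rotate k
  have := isSimpleModule_S hf hc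
  have := isSimpleModule_S hf hd
  obtain ⟨u, v, rfl, rfl⟩ : ∃ u v, c = u ++ v ∧ d = v ++ u := by
    obtain ⟨k, rfl⟩ := h
    exact ⟨_, _, (List.take_append_drop _ _).symm, List.rotate_eq_drop_append_take_mod⟩
  -- The witness `v z` is killed by `f(vu)` because `(vu) v = v (uv)`. It is nonzero because `z` is
  -- a multiple of `uv z`.
  refine nonempty_quotient_span_equiv_iff.2 ⟨pathElt K v • gen f (u ++ v), fun h0 => ?_, ?_⟩
  · have h1 : pathElt K (u ++ v) • gen f (u ++ v) = 0 := by
      refine (congrArg (· • gen f (u ++ v)) (pathElt_append K u v)).trans ?_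
      rw [mul_smul, h0, smul_zero]
    obtain ⟨ρ, hρ⟩ := exists_aeval_smul_gen_eq (d := u ++ v) hf 1
    have h2 := congrArg (aeval (pathElt K (u ++ v))) (mul_comm X ρ)
    rw [map_mul, map_mul, aeval_X] at h2
    rw [map_one, one_smul, h2, mul_smul, h1, smul_zero] at hρ
    exact gen_ne_zero hf hc hρ
  · have key : ∀ π : K[X], aeval (pathElt K (v ++ u)) π * pathElt K v =
        pathElt K v * aeval (pathElt K (u ++ v)) π := by
      intro π
      have hs : SemiconjBy (pathElt K v) (pathElt K (u ++ v)) (pathElt K (v ++ u)) := by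
        rw [SemiconjBy, pathElt_append, pathElt_append, mul_assoc]
      induction π using Polynomial.induction_on' with
      | add p q hp hq => rw [map_add, map_add, add_mul, mul_add, hp, hq]
      | monomial k a =>
        rw [aeval_monomial, aeval_monomial, mul_assoc, ← (hs.pow_right k).eq, ← mul_assoc,
          ← mul_assoc, Algebra.commutes]
    rw [← mul_smul, key, mul_smul, aeval_smul_gen_of_dvd dvd_rfl, smul_zero]

variable {hn : 2 ≤ n} {p q : A K hn}

theorem sigmaHom_pathElt (t : LPA K n) {w : List (Fin n)} (hw : ∀ i ∈ w, i ≠ second hn) :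
    sigmaHom hn t (pathElt K w) = pathElt K w := by
  rw [pathElt, map_list_prod, List.map_map]
  congr 1
  refine List.map_congr_left fun i hi => ?_
  rw [Function.comp_apply, sigmaHom_e, if_neg (hw i hi)]

/-- Both maps fix `w` and `p`, so the two shifts of `e_2` add up. With `t = q` this is how
`σ_p⁻¹(c)` acts on a module twisted by `σ_q`. -/
theorem sigmaHom_sigma_symm_pathElt (t : LPA K n) {w : List (Fin n)}
    (hw : ∀ i ∈ w, i ≠ second hn) :
    sigmaHom hn t ((sigma hn p).symm (pathElt K (w ++ [second hn]))) =
      pathElt K w * (e K (second hn) - e K (first hn) * (p - t)) := by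
  have h1 : (sigma hn p).symm (pathElt K (w ++ [second hn])) =
      sigmaHom hn (-(p : LPA K n)) (pathElt K (w ++ [second hn])) := rfl
  rw [h1, pathElt_append, pathElt_cons, pathElt_nil, mul_one, map_mul, sigmaHom_pathElt _ hw,
    sigmaHom_e, if_pos rfl, map_mul, sigmaHom_pathElt _ hw, map_add, map_mul, map_neg,
    sigmaHom_fix hn t p.2, sigmaHom_e, sigmaHom_e, if_pos rfl, if_neg (first_ne_second hn),
    mul_neg, add_assoc, ← sub_eq_add_neg, ← mul_sub, ← neg_sub (p : LPA K n) t, mul_neg,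
    ← sub_eq_add_neg]

theorem nonempty_Sp_equiv_quotient (f : K[X]) (p : A K hn) (c : List (Fin n)) :
    Nonempty (Sp hn f p c ≃ₗ[LPA K n]
      LPA K n ⧸ Submodule.span (LPA K n) {aeval ((sigma hn p).symm (pathElt K c)) f}) := by
  rw [aeval_algEquiv, AlgHom.comp_apply]
  exact nonempty_twist_quotient_equiv (sigma hn p) (aeval (pathElt K c) f)

theorem nonempty_Sp_equiv_iff (hf : f ∈ Irr K) (hc : IsSimpleClosedPath c) {N : Type*}
    [AddCommGroup N] [Module (LPA K n) N] [IsSimpleModule (LPA K n) N] :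
    Nonempty (Sp hn f p c ≃ₗ[LPA K n] N) ↔
      ∃ y : N, y ≠ 0 ∧ aeval ((sigma hn p).symm (pathElt K c)) f • y = 0 := by
  have := isSimpleModule_S hf hc
  have : IsSimpleModule (LPA K n) (Sp hn f p c) := isSimpleModule_twist _
  obtain ⟨θ⟩ := nonempty_Sp_equiv_quotient f p c
  have := IsSimpleModule.congr θ.symm
  rw [← nonempty_quotient_span_equiv_iff]
  exact ⟨fun ⟨η⟩ => ⟨θ.symm.trans η⟩, fun ⟨η⟩ => ⟨θ.trans η⟩⟩

theorem nonempty_Sp_equiv_Sp_iff {g : K[X]} (hf : f ∈ Irr K) (hg : g ∈ Irr K) (hc : c ∈ Cs hn)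
    (hd : d ∈ Cs hn) :
    Nonempty (Sp hn f p c ≃ₗ[LPA K n] Sp hn g q d) ↔
      f = g ∧ c = d ∧ ∃ r : LPA K n, (p : LPA K n) - q = r * aeval (pathElt K c) f := by
  have := isSimpleModule_S hg hd.1
  have : IsSimpleModule (LPA K n) (Sp hn g q d) := isSimpleModule_twist _
  have hcd := fun h => eq_of_mem_rotations_of_mem_Cs hc hd h
  obtain ⟨hc, w, hw, rfl⟩ := hc
  rw [nonempty_Sp_equiv_iff hf hc]
  have hact : ∀ y : S g d, aeval (sigmaHom hn (q : LPA K n)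
      ((sigma hn p).symm (pathElt K (w ++ [second hn])))) f • y =
      (aeval ((sigma hn p).symm (pathElt K (w ++ [second hn]))) f •
        (show Sp hn g q d from y) : Sp hn g q d) := by
    intro y
    rw [aeval_algHom_apply]
    rfl
  simp only [sigmaHom_sigma_symm_pathElt _ hw] at hact
  constructor
  · rintro ⟨y, hy, h⟩
    have h1 := mem_rotations_and_of_aeval_smul_eq_zero hf hg hc hd.1 (first_ne_second hn) hy
      ((hact y).trans h)
    have h2 := hcd h1.1
    exact ⟨(h1.2 h2).1, h2, (h1.2 h2).2⟩
  · rintro ⟨rfl, rfl, r, hr⟩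
    refine ⟨gen f (w ++ [second hn]), gen_ne_zero hf hc, (hact _).symm.trans ?_⟩
    rw [hr, aeval_smul_gen_eq, aeval_smul_gen_of_dvd dvd_rfl]
    rfl

theorem nonempty_Sp_equiv_S_iff (hf : f ∈ Irr K) (hc : c ∈ Cs hn) (hd : IsSimpleClosedPath d) :
    Nonempty (Sp hn f p c ≃ₗ[LPA K n] S f d) ↔
      d ∈ rotations c ∧ ∃ r : LPA K n, (p : LPA K n) = r * aeval (pathElt K c) f := by
  obtain ⟨hc, w, hw, rfl⟩ := hc
  have hx := sigmaHom_sigma_symm_pathElt (p := p) 0 hw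
  -- The untwisted module is the case `q = 0`.
  have h0 : ∀ r : LPA K n, sigmaHom hn 0 r = r := by
    intro r
    have h1 : sigmaHom hn (0 : LPA K n) = AlgHom.id K _ := algHom_ext
      (fun i => by rw [sigmaHom_e]; split_ifs with hi <;> simp [hi])
      (fun i => by rw [sigmaHom_es]; split_ifs with hi <;> simp [hi])
    rw [h1, AlgHom.id_apply]
  rw [h0, sub_zero] at hx
  have := isSimpleModule_S hf hc
  have := isSimpleModule_S hf hd
  constructor
  · intro h
    have h1 : d ∈ rotations (w ++ [second hn]) := by
      obtain ⟨y, hy, h⟩ := (nonempty_Sp_equiv_iff hf hc).1 h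
      rw [hx] at h
      exact (mem_rotations_and_of_aeval_smul_eq_zero hf hf hc hd (first_ne_second hn) hy h).1
    refine ⟨h1, ?_⟩
    obtain ⟨θ⟩ := h
    -- Replacing `d` by its rotation `c` makes the divisibility half of the support argument
    -- available.
    obtain ⟨η⟩ := nonempty_equiv_of_mem_rotations hf hc h1
    obtain ⟨y, hy, h⟩ := (nonempty_Sp_equiv_iff hf hc).1 ⟨θ.trans η⟩
    rw [hx] at h
    exact ((mem_rotations_and_of_aeval_smul_eq_zero hf hf hc hc (first_ne_second hn) hy h).2
      rfl).2
  · rintro ⟨h1, r, hr⟩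
    obtain ⟨η⟩ := nonempty_equiv_of_mem_rotations hf hc h1
    obtain ⟨θ⟩ : Nonempty (Sp hn f p (w ++ [second hn]) ≃ₗ[LPA K n] S f (w ++ [second hn])) := by
      refine (nonempty_Sp_equiv_iff hf hc).2 ⟨gen f _, gen_ne_zero hf hc, ?_⟩
      rw [hx, hr, aeval_smul_gen_eq, aeval_smul_gen_of_dvd dvd_rfl]
    exact ⟨θ.trans η.symm⟩

end Isomorphisms

end LeavittRose

open LeavittRose
theorem mainTheorem1 {K : Type*} [Field K] {n : ℕ} (hn : 2 ≤ n) (p q : A K hn)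
    (c d : List (Fin n)) (hc : c ∈ Cs hn) (hd : d ∈ Cs hn)
    (f g : K[X]) (hf : f ∈ Irr K) (hg : g ∈ Irr K) :
    IsSimpleModule (LPA K n) (Sp hn f p c) ∧
    (Nonempty (Sp hn f p c ≃ₗ[LPA K n] Sp hn g q d) ↔
      f = g ∧ c = d ∧ ∃ r : LPA K n, (p : LPA K n) - q = r * aeval (pathElt K c) f) ∧
    (∀ α : List (Fin n), IsSimpleClosedPath α →
      ∀ (M : Type*) [AddCommGroup M] [Module (LPA K n) M], IsSPi f α M →
        (Nonempty (Sp hn f p c ≃ₗ[LPA K n] M) ↔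
          α ∈ rotations c ∧ ∃ r : LPA K n, (p : LPA K n) = r * aeval (pathElt K c) f)) ∧
    Nonempty (Module.End (LPA K n) (Sp hn f p c) ≃ₐ[K] K[X] ⧸ Ideal.span {f}) ∧
    Nonempty (Sp hn f p c ≃ₗ[LPA K n]
      LPA K n ⧸ Submodule.span (LPA K n) {aeval ((sigma hn p).symm (pathElt K c)) f}) := by
  have := isSimpleModule_S hf hc.1
  refine ⟨isSimpleModule_twist _, nonempty_Sp_equiv_Sp_iff hf hg hc hd, ?_, ?_,
    nonempty_Sp_equiv_quotient f p c⟩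
  · rintro α hα M _ _ ⟨β, hβ, ⟨θ⟩⟩
    have hβs : IsSimpleClosedPath β := by
      obtain ⟨k, rfl⟩ := hβ
      exact hα.rotate k
    have h1 : Nonempty (Sp hn f p c ≃ₗ[LPA K n] M) ↔
        Nonempty (Sp hn f p c ≃ₗ[LPA K n] S f β) :=
      ⟨fun ⟨η⟩ => ⟨η.trans θ⟩, fun ⟨η⟩ => ⟨η.trans θ.symm⟩⟩
    have h2 : β ∈ rotations c ↔ α ∈ rotations c :=
      ⟨fun h => mem_rotations_of_mem (mem_rotations_symm h) (mem_rotations_symm hβ),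
        fun h => mem_rotations_of_mem (mem_rotations_symm h) hβ⟩
    rw [h1, nonempty_Sp_equiv_S_iff hf hc hβs, h2]
  · obtain ⟨hc, w, -, rfl⟩ := hc
    obtain ⟨θ⟩ := nonempty_end_equiv hf (first_ne_second hn) hc
    exact ⟨(endTwistEquiv (sigma hn p) (S f (w ++ [second hn]))).trans θ⟩
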